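/- **Setting.** Let $a>0$, and let $\mathbb M_2=\mathbb R^2$ be the Minkowski plane with light-cone coordinates $x=(\tau,\xi)$ and $x^2=4\tau\xi$. Configurations are $\varphi\in C^\infty(\mathbb M_2,\mathbb R)$, and $\hbar$ is a formal variable. Let $L_{\rm int}(x)=\cos(a\varphi(x))$. Let $\varphi'=\sum_{\nu\ge0}A_\nu\alpha^\nu$, $A_0=\varphi$, be the formal power series solution of the Bäcklund equation $\tfrac12(\varphi'+\varphi)_\xi=\tfrac1\alpha\sin\big(\tfrac a2(\varphi'-\varphi)\big)$, write $\hat B_{\pm\alpha}\varphi=\sum_\nu A_\nu(\pm\alpha)^\nu$, and let $s_2^N(x)$ ($N\ge 0$) be the value at $x$ of the coefficient of $\alpha^{2N}$ in $$\frac1{\alpha^2}\Big\{2-\cos\big[\tfrac a2(\varphi-\hat B_{-\alpha}\varphi)\big]-\cos\big[\tfrac a2(\varphi-\hat B_{\alpha}\varphi)\big]\Big\}.$$ Let $\Delta^F(x)=-\frac1{4\pi}\log\big(\mu^2(x^2+i0)\big)$ be the massless Feynman propagator, with an arbitrary mass scale $\mu>0$. Put $F\star_F G=\sum_{n\ge0}\frac{\hbar^n}{n!}\big\langle\frac{\delta^nF}{\delta\varphi^n},(\Delta^F)^{\otimes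 n}\frac{\delta^nG}{\delta\varphi^n}\big\rangle$, $T_0=1$ and $T_l(F_1\otimes\dots\otimes F_l)=F_1\star_F\cdots\star_FF_l$. The products of Feynman propagators and of their derivatives that occur are taken as distributions on the set $\check{\mathbb M}_2^{\,n}$ of $n$-tuples of pairwise distinct points; there they are the limits, as $\varepsilon\to0^+$, of the products formed with $\Delta^F_\varepsilon(x)=-\frac1{4\pi}\log\big(\mu^2(x^2+i\varepsilon)\big)$. **Proposition.** For all $l,N\ge0$ and every configuration $\varphi$, the unrenormalized time-ordered product $T_{l+1}\big(L_{\rm int}(x_1)\otimes\dots\otimes L_{\rm int}(x_l)\otimes s_2^N(x_{l+1})\big)$ and all the terms on the right-hand side below are well defined as formal power series in $\hbar$ with coefficients in the distributions in $(x_1,\dots,x_{l+1})\in\check{\mathbb M}_2^{\,l+1}$, and $$T_{l+1}\big(L_{\rm int}^{\otimes l}\otimes s_2^N\big)=\sum_{j=0}^{2(N+1)}\hbar^j\sum_{\substack{j_1,\dots,j_l\ge0\\ j_1+\dots+j_l=j}}\frac1{j_1!\cdots j_l!}\,(\Delta^F)^j\,T_l\Big(\frac{\delta^{j_1}L_{\rm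 int}}{\delta\varphi^{j_1}}\otimes\dots\otimes\frac{\delta^{j_l}L_{\rm int}}{\delta\varphi^{j_l}}\Big)\frac{\delta^js_2^N}{\delta\varphi^j}.$$ Here $(\Delta^F)^j\,T_l(\dots)\,\frac{\delta^j s_2^N}{\delta\varphi^j}$ denotes the pairing with $j$ propagators, each joining one of the $j=j_1+\dots+j_l$ functional-derivative arguments of the factors $L_{\rm int}$ to one of the $j$ functional-derivative arguments of $s_2^N$. -/

import Mathlib

open MeasureTheory Filter Topology
open scoped ContDiff Distributions

namespace SineGordon

noncomputable section

/-! ### Minkowski plane, configurations, observables -/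

/-- The two-dimensional Minkowski space in light-cone coordinates `x = (τ, ξ)`, where
`τ = (x¹ + t) / 2` and `ξ = (x¹ - t) / 2`. -/
abbrev Mink : Type := ℝ × ℝ

/-- The Minkowski square `-t² + (x¹)² = 4 τ ξ`. -/
def minkSq (x : Mink) : ℝ := 4 * x.1 * x.2

/-- The real vector space of smooth real functions on the Minkowski plane. -/
def smoothFunctions : Submodule ℝ (Mink → ℝ) where
  carrier := {φ | ContDiff ℝ ∞ φ}
  add_mem' := by
    intro f g hf hg
    have hf' : ContDiff ℝ ∞ f := hf
    have hg' : ContDiff ℝ ∞ g := hg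
    exact hf'.add hg'
  zero_mem' := (contDiff_const : ContDiff ℝ ∞ (fun _ : Mink => (0 : ℝ)))
  smul_mem' := by
    intro c f hf
    have hf' : ContDiff ℝ ∞ f := hf
    exact hf'.const_smul c

/-- Configurations `φ ∈ C^∞(𝕄₂)`. -/
abbrev Conf : Type := smoothFunctions

/-- Observables: complex functionals of the configuration. With `PowerSeries Obs` we denote formal
power series in `ħ` with coefficients in observables. -/
abbrev Obs : Type := Conf → ℂ

/-- First functional derivative `⟨δF/δφ, h⟩` in the direction `h`. -/
def dirDeriv (h : Conf) (F : Obs) : Obs :=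
  fun φ => deriv (fun t : ℝ => F (φ + t • h)) 0

/-- The `n`-th functional derivative `⟨δⁿF/δφⁿ, h₁ ⊗ ⋯ ⊗ hₙ⟩`. -/
def funcDeriv : (n : ℕ) → (Fin n → Conf) → Obs → Obs
  | 0, _, F => F
  | n + 1, h, F => dirDeriv (h 0) (funcDeriv n (fun i => h i.succ) F)

/-! ### Pairings with smooth propagators, star products, time-ordered products -/

/-- A smooth bump function of integral one, supported in the ball of radius `1 / (k + 1)` about
the origin. -/
def bump (k : ℕ) : ContDiffBump (0 : Mink) where
  rIn := 1 / (2 * (k + 1))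
  rOut := 1 / (k + 1)
  rIn_pos := by positivity
  rIn_lt_rOut := by
    have h : (0 : ℝ) < k + 1 := by positivity
    apply one_div_lt_one_div_of_lt h
    linarith

/-- The approximation `y ↦ ρ_k (y - u)` of the Dirac delta at the point `u`. -/
def deltaApprox (k : ℕ) (u : Mink) : Conf :=
  ⟨fun y => (bump k).normed volume (y - u),
    ((bump k).contDiff_normed (n := ⊤)).comp (contDiff_id.sub contDiff_const)⟩

/-- The pairing `⟨A, H^{⊗n} B⟩ = ∫∫ A(u₁,…,uₙ) H(u₁ - v₁) ⋯ H(uₙ - vₙ) B(v₁,…,vₙ) du dv` of two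
compactly supported distributions `A`, `B` on `𝕄₂ⁿ`, given by their values on tensor products
`h₁ ⊗ ⋯ ⊗ hₙ`, with a product of smooth translation-invariant kernels. The integral kernel
`A(u₁,…,uₙ)` is the weak limit of the smooth functions `A(δ_{u₁} ⊗ ⋯ ⊗ δ_{uₙ})`, the deltas being
replaced by approximations. -/
def pairing (n : ℕ) (H : Mink → ℂ) (A B : (Fin n → Conf) → ℂ) : ℂ :=
  limUnder atTop (fun k : ℕ => ∫ u : Fin n → Mink, ∫ v : Fin n → Mink,
    A (fun i => deltaApprox k (u i)) * (∏ i, H (u i - v i)) * B (fun i => deltaApprox k (v i)))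

/-- The product `F ⋆_H G = ∑ₙ ħⁿ/n! ⟨δⁿF/δφⁿ, H^{⊗n} δⁿG/δφⁿ⟩` of formal power series in `ħ`. -/
def star (H : Mink → ℂ) (F G : PowerSeries Obs) : PowerSeries Obs :=
  PowerSeries.mk fun p => fun φ =>
    ∑ n ∈ Finset.range (p + 1), ∑ bc ∈ Finset.HasAntidiagonal.antidiagonal (p - n),
      ((n.factorial : ℂ))⁻¹ * pairing n H
        (fun h => funcDeriv n h (PowerSeries.coeff bc.1 F) φ)
        (fun h => funcDeriv n h (PowerSeries.coeff bc.2 G) φ)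

/-- `T_l(F₁ ⊗ ⋯ ⊗ F_l) = F₁ ⋆_H ⋯ ⋆_H F_l`, with `T_0 = 1`. -/
def timeOrdered (H : Mink → ℂ) : (l : ℕ) → (Fin l → PowerSeries Obs) → PowerSeries Obs
  | 0, _ => 1
  | l + 1, F => star H (timeOrdered H l (fun i => F i.castSucc)) (F (Fin.last l))

/-- The massless Feynman propagator `Δ^F(x) = -1/(4π) log(μ² (x² + i0))` with mass scale `μ`:
for `ε = 0` this is the locally integrable function `Δ^F`, and for `ε > 0` it is the smooth function
`Δ^F_ε(x) = -1/(4π) log(μ² (x² + iε))` of which it is the boundary value. -/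
def feynman (μ ε : ℝ) (x : Mink) : ℂ :=
  -(1 / (4 * (Real.pi : ℂ))) *
    Complex.log ((μ : ℂ) ^ 2 * ((minkSq x : ℂ) + (ε : ℂ) * Complex.I))

/-! ### Distributions off the diagonals -/

/-- The set of `n`-tuples of pairwise different points. -/
def offDiag (n : ℕ) : TopologicalSpace.Opens (Fin n → Mink) where
  carrier := {x | Function.Injective x}
  is_open' := by
    have h : {x : Fin n → Mink | Function.Injective x} =
        ⋂ i, ⋂ j, ⋂ _ : i ≠ j, {x : Fin n → Mink | x i ≠ x j} := by
      ext x
      simp only [Set.mem_ofPred_eq, Set.mem_iInter]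
      exact ⟨fun hx i j hij hxy => hij (hx hxy),
        fun hx i j hxy => by_contra fun hij => hx i j hij hxy⟩
    rw [h]
    refine isOpen_iInter_of_finite fun i => isOpen_iInter_of_finite fun j =>
      isOpen_iInter_of_finite fun _ => ?_
    exact isOpen_ne_fun (continuous_apply i) (continuous_apply j)

/-- `u` is the limit, as `ε → 0+`, of the functions `K ε`, in the sense of distributions on the
set of tuples of pairwise different points. -/
def IsBoundaryValue {n : ℕ} (K : ℝ → (Fin n → Mink) → ℂ) (u : 𝓓'(offDiag n, ℂ)) : Prop :=
  ∀ f : 𝓓(offDiag n, ℝ),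
    Tendsto (fun ε : ℝ => ∫ x, K ε x * (f x : ℂ)) (𝓝[>] 0) (𝓝 (u f))

open Classical in
/-- The limit of `K ε` as `ε → 0+` in the sense of distributions (zero if there is none).
Off the diagonals, products of Feynman propagators and of their derivatives, which exist there by
Hörmander's criterion, are the limits of the products of the regularised propagators `Δ^F_ε`, because
`Δ^F_ε → Δ^F` in the spaces of distributions with controlled wave front set, on which
multiplication is continuous. -/
def boundaryValue {n : ℕ} (K : ℝ → (Fin n → Mink) → ℂ) : 𝓓'(offDiag n, ℂ) :=
  if h : ∃ u, IsBoundaryValue K u then h.choose else 0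

/-! ### The sine-Gordon fields -/

/-- The interaction Lagrangian `L_int(x) = cos(a φ(x))`. -/
def lInt (a : ℝ) (x : Mink) : Obs := fun φ => (Real.cos (a * φ.1 x) : ℂ)

/-- `∂f/∂ξ`. -/
def dXi (f : Mink → ℝ) : Mink → ℝ := fun x => deriv (fun s => f (x.1, s)) x.2

/-- `∂/∂ξ` on formal power series in `α`, coefficientwise. -/
def dXiSeries (Φ : PowerSeries (Mink → ℝ)) : PowerSeries (Mink → ℝ) :=
  PowerSeries.mk fun n => dXi (PowerSeries.coeff n Φ)

/-- The formal power series `φ' = ∑ A_ν αᵛ`, `A_0 = φ`, solves the equation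
`½ (φ' + φ)_ξ = (1/α) sin(½ a (φ' - φ))` of the extended Bäcklund transformation (multiplied
by `α`). -/
def IsBacklundSeries (a : ℝ) (φ : Mink → ℝ) (Φ : PowerSeries (Mink → ℝ)) : Prop :=
  PowerSeries.coeff 0 Φ = φ ∧
    PowerSeries.X * dXiSeries ((1 / 2 : ℝ) • (Φ + PowerSeries.C φ)) =
      (PowerSeries.sin (Mink → ℝ)).subst ((a / 2 : ℝ) • (Φ - PowerSeries.C φ))


theorem coeff_sin_subst {B P : PowerSeries (Mink → ℝ)} (hB : PowerSeries.constantCoeff B = 0)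
    {n : ℕ} (hn : 0 < n)
    (hP : ∀ k, PowerSeries.coeff k P = if k < n then PowerSeries.coeff k B else 0) :
    PowerSeries.coeff n ((PowerSeries.sin (Mink → ℝ)).subst B) =
      PowerSeries.coeff n B + PowerSeries.coeff n ((PowerSeries.sin (Mink → ℝ)).subst P) := by
  have hP0 : PowerSeries.constantCoeff P = 0 := by
    rw [← PowerSeries.coeff_zero_eq_constantCoeff_apply, hP, if_pos hn,
      PowerSeries.coeff_zero_eq_constantCoeff_apply, hB]
  have hBs := PowerSeries.HasSubst.of_constantCoeff_zero' hB
  have hPs := PowerSeries.HasSubst.of_constantCoeff_zero' hP0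
  obtain ⟨Q, hQ⟩ : (PowerSeries.X : PowerSeries (Mink → ℝ)) ^ n ∣ B - P := by
    rw [PowerSeries.X_pow_dvd_iff]
    intro m hm
    rw [map_sub, hP, if_pos hm, sub_self]
  have key : ∀ d : ℕ, PowerSeries.coeff d (PowerSeries.sin (Mink → ℝ)) •
        PowerSeries.coeff n (B ^ d) =
      (if d = 1 then PowerSeries.coeff n B else 0) +
        PowerSeries.coeff d (PowerSeries.sin (Mink → ℝ)) • PowerSeries.coeff n (P ^ d) := by
    intro d
    match d with
    | 0 => simp
    | 1 =>
      have : PowerSeries.coeff n P = 0 := by rw [hP, if_neg (lt_irrefl n)]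
      simp [this, PowerSeries.sin]
    | d + 2 =>
      have h2 : PowerSeries.coeff n (B ^ (d + 2)) = PowerSeries.coeff n (P ^ (d + 2)) := by
        rw [← sub_eq_zero, ← map_sub, ← geom_sum₂_mul, hQ, mul_left_comm,
          PowerSeries.coeff_X_pow_mul', if_pos le_rfl, Nat.sub_self,
          PowerSeries.coeff_zero_eq_constantCoeff_apply, map_mul, map_sum]
        rw [Finset.sum_eq_zero, zero_mul]
        intro i hi
        rw [map_mul, map_pow, map_pow, hB, hP0]
        rcases Nat.eq_zero_or_pos i with h0 | h0
        · rw [h0, pow_zero, one_mul]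
          exact zero_pow (by omega)
        · rw [zero_pow h0.ne', zero_mul]
      rw [h2]; simp
  rw [PowerSeries.coeff_subst' hBs, PowerSeries.coeff_subst' hPs, finsum_congr key,
    finsum_add_distrib]
  · congr 1
    rw [finsum_eq_single _ 1 (fun d hd => if_neg hd), if_pos rfl]
  · exact (Set.finite_singleton 1).subset (by
      intro d hd
      by_contra h
      exact hd (if_neg h))
  · exact PowerSeries.coeff_subst_finite' hPs _ _

/-- The part of order less than `n` of `½ a (∑ A_ν αᵛ - A_0)`. -/
def backlundPart (a : ℝ) (n : ℕ) (A : ℕ → Mink → ℝ) : PowerSeries (Mink → ℝ) :=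
  PowerSeries.mk fun k => if k < n then (a / 2 : ℝ) • (A k - if k = 0 then A k else 0) else 0

theorem isBacklundSeries_iff {a : ℝ} (ha : a ≠ 0) (φ : Mink → ℝ) (A : ℕ → Mink → ℝ) :
    IsBacklundSeries a φ (PowerSeries.mk A) ↔ A 0 = φ ∧ ∀ n, A (n + 1) =
      (2 / a : ℝ) • (dXi ((1 / 2 : ℝ) • (A n + if n = 0 then φ else 0)) -
        PowerSeries.coeff (n + 1)
          ((PowerSeries.sin (Mink → ℝ)).subst (backlundPart a (n + 1) A))) := by
  unfold IsBacklundSeries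
  rw [PowerSeries.coeff_mk]
  refine and_congr_right fun h0 => ?_
  have hB : PowerSeries.constantCoeff
      ((a / 2 : ℝ) • (PowerSeries.mk A - PowerSeries.C φ)) = 0 := by
    rw [← PowerSeries.coeff_zero_eq_constantCoeff_apply, PowerSeries.coeff_smul, map_sub,
      PowerSeries.coeff_mk, PowerSeries.coeff_C, if_pos rfl, h0, sub_self, smul_zero]
  have hstep : ∀ n, PowerSeries.coeff (n + 1) ((PowerSeries.sin (Mink → ℝ)).subst
        ((a / 2 : ℝ) • (PowerSeries.mk A - PowerSeries.C φ))) =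
      (a / 2 : ℝ) • A (n + 1) + PowerSeries.coeff (n + 1)
          ((PowerSeries.sin (Mink → ℝ)).subst (backlundPart a (n + 1) A)) := by
    intro n
    rw [coeff_sin_subst hB (Nat.succ_pos n) (P := backlundPart a (n + 1) A)]
    · simp
    · intro k
      by_cases hk : k < n + 1
      · by_cases hk0 : k = 0
        · subst hk0
          simp [backlundPart, h0]
        · simp [backlundPart, PowerSeries.coeff_C, hk0]
      · rw [if_neg hk, backlundPart, PowerSeries.coeff_mk, if_neg hk]
  have hleft : ∀ n, PowerSeries.coeff (n + 1) (PowerSeries.X *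
        dXiSeries ((1 / 2 : ℝ) • (PowerSeries.mk A + PowerSeries.C φ))) =
      dXi ((1 / 2 : ℝ) • (A n + if n = 0 then φ else 0)) := by
    intro n
    rw [PowerSeries.coeff_succ_X_mul, dXiSeries, PowerSeries.coeff_mk, PowerSeries.coeff_smul,
      map_add, PowerSeries.coeff_mk, PowerSeries.coeff_C]
  have haux : ∀ x y z : Mink → ℝ, y = (a / 2 : ℝ) • x + z ↔ x = (2 / a : ℝ) • (y - z) := by
    intro x y z
    constructor
    · rintro rfl
      rw [add_sub_cancel_right, smul_smul]
      rw [show 2 / a * (a / 2) = 1 by field_simp, one_smul]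
    · rintro rfl
      rw [smul_smul, show a / 2 * (2 / a) = 1 by field_simp, one_smul, sub_add_cancel]
  constructor
  · intro h n
    rw [← haux, ← hstep, ← hleft, h]
  · intro h
    ext1 m
    rcases m with _ | n
    · rw [PowerSeries.coeff_zero_X_mul, PowerSeries.coeff_zero_eq_constantCoeff_apply]
      exact (PowerSeries.constantCoeff_subst_eq_zero hB _ (by
        rw [← PowerSeries.coeff_zero_eq_constantCoeff_apply]
        simp [PowerSeries.sin])).symm
    · rw [hleft, hstep, haux, ← h n]

theorem backlundPart_congr {a : ℝ} {n : ℕ} {A A' : ℕ → Mink → ℝ} (h : ∀ k < n, A k = A' k) :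
    backlundPart a n A = backlundPart a n A' := by
  ext1 k
  by_cases hk : k < n
  · simp [backlundPart, hk, h k hk]
  · simp [backlundPart, hk]

/-- The coefficients `A_ν` computed one after the other. -/
def backlundRec (a : ℝ) (φ : Mink → ℝ) : ℕ → Mink → ℝ
  | 0 => φ
  | n + 1 => (2 / a : ℝ) • (dXi ((1 / 2 : ℝ) • (backlundRec a φ n + if n = 0 then φ else 0)) -
        PowerSeries.coeff (n + 1) ((PowerSeries.sin (Mink → ℝ)).subst
          (backlundPart a (n + 1) fun k => if _h : k < n + 1 then backlundRec a φ k else 0)))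

theorem existsUnique_backlundSeries {a : ℝ} (ha : a ≠ 0) (φ : Mink → ℝ) :
    ∃! Φ, IsBacklundSeries a φ Φ := by
  refine ⟨PowerSeries.mk (backlundRec a φ), ?_, ?_⟩
  · refine (isBacklundSeries_iff ha φ _).2 ⟨by rw [backlundRec], fun n => ?_⟩
    rw [backlundRec]
    congr 4
    exact backlundPart_congr fun k hk => by simp [hk]
  · intro Φ hΦ
    obtain ⟨A, rfl⟩ : ∃ A, Φ = PowerSeries.mk A :=
      ⟨fun n => PowerSeries.coeff n Φ, by ext1 n; simp⟩
    obtain ⟨h0, h1⟩ := (isBacklundSeries_iff ha φ A).1 hΦ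
    have : ∀ n, A n = backlundRec a φ n := by
      intro n
      induction n using Nat.strong_induction_on with
      | _ n ih =>
        rcases n with _ | n
        · rw [h0, backlundRec]
        · rw [h1, backlundRec, ih n (Nat.lt_succ_self n)]
          congr 4
          exact backlundPart_congr fun k hk => by simp [hk, ih k hk]
    rw [funext this]

open Classical in
/-- The formal power series `φ' = B̂_α φ = ∑ A_ν αᵛ`: the unique solution of the equation of the
extended Bäcklund transformation (for `a ≠ 0`). -/
def backlundSeries (a : ℝ) (φ : Mink → ℝ) : PowerSeries (Mink → ℝ) :=
  if h : ∃ Φ, IsBacklundSeries a φ Φ then h.choose else 0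

/-- The power series `α² s₂^{(α)} = 2 - cos(½ a (φ - B̂_{-α} φ)) - cos(½ a (φ - B̂_α φ))`. -/
def currentSeries (a : ℝ) (φ : Mink → ℝ) : PowerSeries (Mink → ℝ) :=
  2 - (PowerSeries.cos (Mink → ℝ)).subst ((a / 2 : ℝ) •
        (PowerSeries.C φ - PowerSeries.rescale (-1 : Mink → ℝ) (backlundSeries a φ)))
    - (PowerSeries.cos (Mink → ℝ)).subst ((a / 2 : ℝ) •
        (PowerSeries.C φ - backlundSeries a φ))

/-- The field `s₂^N(x)`: the coefficient of `α^{2N}` in `s₂^{(α)}`, at the point `x`. -/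
def s2 (a : ℝ) (N : ℕ) (x : Mink) : Obs :=
  fun φ => (PowerSeries.coeff (2 * N + 2) (currentSeries a φ.1) x : ℂ)

/-! ### The two sides of the expansion -/

/-- The regularised coefficient of `ħ^p` in `T_{l+1}(L_int(x₁) ⊗ ⋯ ⊗ L_int(x_l) ⊗ s₂^N(x_{l+1}))`,
evaluated at the configuration `φ`. -/
def lhsKernel (a μ : ℝ) (l N : ℕ) (φ : Conf) (p : ℕ) (ε : ℝ) (x : Fin (l + 1) → Mink) : ℂ :=
  PowerSeries.coeff p (timeOrdered (feynman μ ε) (l + 1)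
    (Fin.snoc (fun i : Fin l => PowerSeries.C (lInt a (x i.castSucc)))
      (PowerSeries.C (s2 a N (x (Fin.last l)))))) φ

/-- The regularised coefficient of `ħ^q` in
`(Δ^F)^j T_l(δ^{j₁}L_int/δφ^{j₁}(x₁) ⊗ ⋯ ⊗ δ^{j_l}L_int/δφ^{j_l}(x_l)) δ^j s₂^N/δφ^j(x_{l+1})`, where
`j = j₁ + ⋯ + j_l`, evaluated at `φ`. The `j = j₁ + ⋯ + j_l` arguments of the functional derivatives
of the interaction Lagrangians are distributed over the factors in consecutive blocks, and each of
them is joined by one propagator to one of the arguments of the `j`-th functional derivative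
of `s₂^N`. -/
def termKernel (a μ : ℝ) (l N : ℕ) (φ : Conf) (J : Fin l → ℕ) (q : ℕ) (ε : ℝ)
    (x : Fin (l + 1) → Mink) : ℂ :=
  pairing (∑ i, J i) (feynman μ ε)
    (fun h => PowerSeries.coeff q (timeOrdered (feynman μ ε) l (fun i =>
      PowerSeries.C (funcDeriv (J i) (fun k => h (finSigmaFinEquiv ⟨i, k⟩))
        (lInt a (x i.castSucc))))) φ)
    (fun h => funcDeriv (∑ i, J i) h (s2 a N (x (Fin.last l))) φ)

/-- The unrenormalized `T_{l+1}(L_int^{⊗l} ⊗ s₂^N)`, evaluated at `φ`, as a formal power series in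
`ħ` (a sequence of coefficients) of distributions. -/
def unrenormT (a μ : ℝ) (l N : ℕ) (φ : Conf) : ℕ → 𝓓'(offDiag (l + 1), ℂ) :=
  fun p => boundaryValue (lhsKernel a μ l N φ p)

/-- The term `(Δ^F)^j T_l(δ^{j₁}L_int ⊗ ⋯ ⊗ δ^{j_l}L_int) δ^j s₂^N`, `J = (j₁,…,j_l)`, evaluated at
`φ`, as a formal power series in `ħ` of distributions. -/
def unrenormTerm (a μ : ℝ) (l N : ℕ) (φ : Conf) (J : Fin l → ℕ) : ℕ → 𝓓'(offDiag (l + 1), ℂ) :=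
  fun q => boundaryValue (termKernel a μ l N φ J q)

/-- Multiplication of a formal power series in `ħ` by `ħ^j`. -/
def hbarPow {V : Type*} [Zero V] (j : ℕ) (u : ℕ → V) : ℕ → V :=
  fun p => if j ≤ p then u (p - j) else 0

end

end SineGordon

/-! The proof has an algebraic half, an exact identity between the regularised kernels at each fixed
ε > 0, and an analytic half, the existence of their limits off the diagonals.

Algebra. The cosine is a sum of two exponentials of linear functionals of φ, and such exponentials
are eigenvectors of every functional derivative (`funcDeriv_sum_exp`). Hence a time-ordered product
of vertex operators is their ordinary product times the exponential of ħ times the sum of all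
connecting propagators (`coeff_timeOrdered`). On the other side, the Bäcklund recursion shows that
the coefficient of α^n in the current is a polynomial of degree at most n in the ξ-jets of φ
(`isJetPoly_coeff_currentSeries`). So the derivatives of s₂^N of order above 2N + 2 vanish, which
bounds j, and the others are sums of products of point functionals. A pairing then factorises into
single contractions (`pairing_eq_sum`). In the n-th term of the last star product each of the n
propagators chooses one of the l vertices. By symmetry of the derivatives of s₂^N only the fibre
sizes of this choice matter, and counting the choices turns 1/n! into 1/(j₁! ⋯ j_l!)
(`sum_pi_eq_sum_finAntidiagonal`, `lhsKernel_eq`).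

Analysis. A direct argument replaces the wave front set criterion. If all points are rotated
simultaneously by the imaginary hyperbolic angle iθ, the square 4τξ of every difference acquires the
imaginary part 4 cos θ sin θ (τ² + ξ²). For θ > 0 the propagators between distinct points therefore
need no regulator, and products of their derivatives grow at most like a power θ^(-M), uniformly in
ε. Differentiation in θ is i times differentiation along the boost field, and integration by parts
moves it to the test function. Taylor's formula based at θ = π/4 expresses the integral at θ = 0
through finitely many integrals at π/4 and a remainder with weight θ^M, which absorbs the growth
(`exists_tendsto_of_taylor`). This gives convergence together with a bound by finitely many
derivatives of the test function, hence a distribution (`IsWickRotatable.hasBoundaryValue`).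
Linearity of limits transfers the regularised identity to the boundary values. -/

namespace SineGordon

noncomputable section

/-! ### The Wick rotation -/

/-- The hyperbolic rotation of the Minkowski plane by the imaginary angle `iθ`. -/
def wickCLM (θ : ℝ) : Mink →L[ℝ] ℂ × ℂ :=
  ((Real.cos θ • Complex.ofRealCLM.comp (ContinuousLinearMap.fst ℝ ℝ ℝ)) +
    (Complex.I * Real.sin θ) • Complex.ofRealCLM.comp (ContinuousLinearMap.snd ℝ ℝ ℝ)).prod
  ((Real.cos θ • Complex.ofRealCLM.comp (ContinuousLinearMap.snd ℝ ℝ ℝ)) +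
    (Complex.I * Real.sin θ) • Complex.ofRealCLM.comp (ContinuousLinearMap.fst ℝ ℝ ℝ))

theorem wickCLM_apply (θ : ℝ) (z : Mink) :
    wickCLM θ z = ((Real.cos θ : ℂ) * z.1 + Complex.I * Real.sin θ * z.2,
      (Real.cos θ : ℂ) * z.2 + Complex.I * Real.sin θ * z.1) := by
  simp [wickCLM]

/-- The simultaneous Wick rotation of all points of a tuple. -/
def wickTuple {n : ℕ} (θ : ℝ) : (Fin n → Mink) →L[ℝ] (Fin n → ℂ × ℂ) :=
  ContinuousLinearMap.pi fun i => (wickCLM θ).comp (ContinuousLinearMap.proj i)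

@[simp]
theorem wickTuple_apply {n : ℕ} (θ : ℝ) (x : Fin n → Mink) (i : Fin n) :
    wickTuple θ x i = wickCLM θ (x i) := rfl

/-- The generator `(τ, ξ) ↦ (ξ, τ)` of the hyperbolic rotations, acting on all points of a tuple. -/
def boost {n : ℕ} : (Fin n → Mink) →L[ℝ] (Fin n → Mink) :=
  ContinuousLinearMap.pi fun i =>
    ((ContinuousLinearMap.snd ℝ ℝ ℝ).prod (ContinuousLinearMap.fst ℝ ℝ ℝ)).comp
      (ContinuousLinearMap.proj i)

@[simp]
theorem boost_apply {n : ℕ} (x : Fin n → Mink) (i : Fin n) : boost x i = ((x i).2, (x i).1) := rfl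

/-- The generator commutes with the rotation, so it may act on the real tuple first. In this form
the θ-derivative of a rotated kernel becomes a derivative along a real vector field. -/
theorem hasDerivAt_wickTuple {n : ℕ} (θ : ℝ) (x : Fin n → Mink) :
    HasDerivAt (fun t => wickTuple t x) (Complex.I • wickTuple θ (boost x)) θ := by
  rw [hasDerivAt_pi]
  intro i
  have hc : HasDerivAt (fun t : ℝ => (Real.cos t : ℂ)) (-(Real.sin θ : ℂ)) θ := by
    simpa using (Real.hasDerivAt_cos θ).ofReal_comp
  have hs : HasDerivAt (fun t : ℝ => (Real.sin t : ℂ)) (Real.cos θ : ℂ) θ :=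
    (Real.hasDerivAt_sin θ).ofReal_comp
  simp only [wickTuple_apply, wickCLM_apply, Pi.smul_apply, boost_apply, Prod.smul_mk]
  refine HasDerivAt.prodMk ?_ ?_
  · refine ((hc.mul_const _).add ((hs.const_mul Complex.I).mul_const _)).congr_deriv ?_
    rw [smul_eq_mul]
    linear_combination (-(Real.sin θ : ℂ) * (x i).1) * Complex.I_sq
  · refine ((hc.mul_const _).add ((hs.const_mul Complex.I).mul_const _)).congr_deriv ?_
    rw [smul_eq_mul]
    linear_combination (-(Real.sin θ : ℂ) * (x i).2) * Complex.I_sq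

theorem continuous_wickTuple_uncurry {n : ℕ} :
    Continuous fun p : ℝ × (Fin n → Mink) => wickTuple p.1 p.2 := by
  refine continuous_pi fun i => ?_
  simp only [wickTuple_apply, wickCLM_apply]
  fun_prop

/-! ### Integration by parts along the boosts -/

/-- The condition `c v = 0` makes the coordinate `c` constant along `v`, so integration by parts
leaves no term with a derivative of `c`. -/
theorem integral_fderiv_coord_mul {n : ℕ} {κ f : (Fin n → Mink) → ℂ} (hκ : ContDiff ℝ 1 κ)
    (hf : ContDiff ℝ 1 f) (hc : HasCompactSupport f) (c : (Fin n → Mink) →L[ℝ] ℝ)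
    (v : Fin n → Mink) (hcv : c v = 0) :
    ∫ x, fderiv ℝ κ x v * ((c x : ℂ) * f x) = -∫ x, κ x * ((c x : ℂ) * fderiv ℝ f x v) := by
  have hcx : ContDiff ℝ 1 fun x => (c x : ℂ) := Complex.ofRealCLM.contDiff.comp c.contDiff
  have hg : ContDiff ℝ 1 fun x => (c x : ℂ) * f x := hcx.mul hf
  have hgc : HasCompactSupport fun x => (c x : ℂ) * f x := hc.mul_left
  have hg' : ∀ x, fderiv ℝ (fun x => (c x : ℂ) * f x) x v = (c x : ℂ) * fderiv ℝ f x v := by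
    intro x
    rw [fderiv_fun_mul (hcx.differentiable (by norm_num) x) (hf.differentiable (by norm_num) x)]
    have : fderiv ℝ (fun x => (c x : ℂ)) x = Complex.ofRealCLM.comp c :=
      (Complex.ofRealCLM.comp c).fderiv
    simp [this, hcv]
  have hcont : ∀ {g : (Fin n → Mink) → ℂ}, ContDiff ℝ 1 g → Continuous fun x => fderiv ℝ g x v :=
    fun hg => (hg.continuous_fderiv (by norm_num)).clm_apply continuous_const
  have hgc' : HasCompactSupport fun x => fderiv ℝ (fun x => (c x : ℂ) * f x) x v :=
    (hgc.fderiv ℝ).comp_left (g := fun L : (Fin n → Mink) →L[ℝ] ℂ => L v) rfl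
  have := integral_mul_fderiv_eq_neg_fderiv_mul_of_integrable (μ := (volume : Measure (Fin n → Mink)))
    (f := κ) (g := fun x => (c x : ℂ) * f x) (v := v)
    (((hcont hκ).mul hg.continuous).integrable_of_hasCompactSupport hgc.mul_left)
    ((hκ.continuous.mul (hcont hg)).integrable_of_hasCompactSupport hgc'.mul_left)
    ((hκ.continuous.mul hg.continuous).integrable_of_hasCompactSupport hgc.mul_left)
    (fun x _ => hκ.differentiable (by norm_num) x) (fun x _ => hg.differentiable (by norm_num) x)
  simp_rw [hg'] at this
  rw [this, neg_neg]

theorem boost_eq_sum {n : ℕ} (x : Fin n → Mink) :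
    boost x = ∑ i, ((x i).2 • (Pi.single i (1, 0) : Fin n → Mink) +
      (x i).1 • (Pi.single i (0, 1) : Fin n → Mink)) := by
  ext j <;> simp [Finset.sum_apply, Pi.single_apply, apply_ite Prod.fst, apply_ite Prod.snd,
    Prod.fst_sum, Prod.snd_sum]

/-- The boost field is divergence-free: each ∂/∂τ is multiplied by a ξ-coordinate and vice versa. It
is therefore formally antisymmetric. -/
theorem integral_fderiv_boost_mul {n : ℕ} {κ f : (Fin n → Mink) → ℂ} (hκ : ContDiff ℝ 1 κ)
    (hf : ContDiff ℝ 1 f) (hc : HasCompactSupport f) :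
    ∫ x, fderiv ℝ κ x (boost x) * f x = -∫ x, κ x * fderiv ℝ f x (boost x) := by
  let c₁ : Fin n → (Fin n → Mink) →L[ℝ] ℝ := fun i =>
    (ContinuousLinearMap.snd ℝ ℝ ℝ).comp (ContinuousLinearMap.proj i)
  let c₂ : Fin n → (Fin n → Mink) →L[ℝ] ℝ := fun i =>
    (ContinuousLinearMap.fst ℝ ℝ ℝ).comp (ContinuousLinearMap.proj i)
  have hcont : ∀ {g : (Fin n → Mink) → ℂ} (v), ContDiff ℝ 1 g → Continuous fun x => fderiv ℝ g x v :=
    fun v hg => (hg.continuous_fderiv (by norm_num)).clm_apply continuous_const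
  have hcx : ∀ c : (Fin n → Mink) →L[ℝ] ℝ, Continuous fun x => (c x : ℂ) := fun c =>
    Complex.continuous_ofReal.comp c.continuous
  have hI : ∀ (c : (Fin n → Mink) →L[ℝ] ℝ) (v : Fin n → Mink),
      Integrable fun x => fderiv ℝ κ x v * ((c x : ℂ) * f x) := fun c v =>
    ((hcont v hκ).mul ((hcx c).mul hf.continuous)).integrable_of_hasCompactSupport
      hc.mul_left.mul_left
  have hJ : ∀ (c : (Fin n → Mink) →L[ℝ] ℝ) (v : Fin n → Mink),
      Integrable fun x => κ x * ((c x : ℂ) * fderiv ℝ f x v) := fun c v =>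
    (hκ.continuous.mul ((hcx c).mul (hcont v hf))).integrable_of_hasCompactSupport
      (((hc.fderiv ℝ).comp_left (g := fun L : (Fin n → Mink) →L[ℝ] ℂ => L v) rfl).mul_left.mul_left)
  have h1 : ∀ x, fderiv ℝ κ x (boost x) * f x =
      ∑ i, (fderiv ℝ κ x (Pi.single i ((1, 0) : Mink)) * ((c₁ i x : ℂ) * f x) +
        fderiv ℝ κ x (Pi.single i ((0, 1) : Mink)) * ((c₂ i x : ℂ) * f x)) := by
    intro x
    rw [boost_eq_sum, map_sum, Finset.sum_mul]
    refine Finset.sum_congr rfl fun i _ => ?_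
    rw [map_add, map_smul, map_smul, Complex.real_smul, Complex.real_smul]
    simp only [c₁, c₂, ContinuousLinearMap.comp_apply, ContinuousLinearMap.proj_apply,
      ContinuousLinearMap.coe_fst', ContinuousLinearMap.coe_snd']
    ring
  have h2 : ∀ x, κ x * fderiv ℝ f x (boost x) =
      ∑ i, (κ x * ((c₁ i x : ℂ) * fderiv ℝ f x (Pi.single i ((1, 0) : Mink))) +
        κ x * ((c₂ i x : ℂ) * fderiv ℝ f x (Pi.single i ((0, 1) : Mink)))) := by
    intro x
    rw [boost_eq_sum, map_sum, Finset.mul_sum]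
    refine Finset.sum_congr rfl fun i _ => ?_
    rw [map_add, map_smul, map_smul, Complex.real_smul, Complex.real_smul]
    simp only [c₁, c₂, ContinuousLinearMap.comp_apply, ContinuousLinearMap.proj_apply,
      ContinuousLinearMap.coe_fst', ContinuousLinearMap.coe_snd']
    ring
  simp_rw [h1, h2]
  rw [integral_finsetSum _ fun i _ => by exact (hI _ _).add (hI _ _),
    integral_finsetSum _ fun i _ => by exact (hJ _ _).add (hJ _ _), ← Finset.sum_neg_distrib]
  refine Finset.sum_congr rfl fun i _ => ?_
  rw [integral_add (hI _ _) (hI _ _), integral_add (hJ _ _) (hJ _ _),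
    integral_fderiv_coord_mul hκ hf hc _ _ (by simp [c₁]),
    integral_fderiv_coord_mul hκ hf hc _ _ (by simp [c₂]), neg_add]

/-! ### Limits by Taylor expansion away from the singularity -/

/-- The derivative of Σ (-θ)^n/n! Ψ_n(θ) telescopes to its last term (-θ)^M/M! Ψ_{M+1}(θ), and at θ
= 0 only the summand n = 0 survives. Only interior derivatives are required, so the formula can be
based at b although the value at 0 is wanted. -/
theorem taylor_from_endpoint {b : ℝ} (hb : 0 ≤ b) {Ψ : ℕ → ℝ → ℂ}
    (hc : ∀ n, ContinuousOn (Ψ n) (Set.Icc 0 b))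
    (hd : ∀ n, ∀ θ ∈ Set.Ioo 0 b, HasDerivAt (Ψ n) (Ψ (n + 1) θ) θ) (M : ℕ) :
    Ψ 0 0 = ∑ n ∈ Finset.range (M + 1), (((-b) ^ n / n.factorial : ℝ) : ℂ) * Ψ n b -
      ∫ θ in (0 : ℝ)..b, (((-θ) ^ M / M.factorial : ℝ) : ℂ) * Ψ (M + 1) θ := by
  have hpc : ∀ n : ℕ, Continuous fun θ : ℝ => (((-θ) ^ n / n.factorial : ℝ) : ℂ) := by
    intro n; fun_prop
  have hmon : ∀ (n : ℕ) (θ : ℝ), HasDerivAt (fun θ : ℝ => (((-θ) ^ (n + 1) / (n + 1).factorial : ℝ) : ℂ))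
      (-(((-θ) ^ n / n.factorial : ℝ) : ℂ)) θ := by
    intro n θ
    have h := (((hasDerivAt_id θ).neg.pow (n + 1)).div_const ((n + 1).factorial : ℝ)).ofReal_comp
    refine h.congr_deriv ?_
    rw [← Complex.ofReal_neg]
    congr 1
    have : ((n.factorial : ℝ)) ≠ 0 := by positivity
    have : ((n : ℝ) + 1) ≠ 0 := by positivity
    simp only [Nat.factorial_succ, Nat.cast_mul, Nat.cast_add, Nat.cast_one, Pi.neg_apply, id]
    field_simp
    simp
  have hder : ∀ M : ℕ, ∀ θ ∈ Set.Ioo 0 b, HasDerivAt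
      (fun θ => ∑ n ∈ Finset.range (M + 1), (((-θ) ^ n / n.factorial : ℝ) : ℂ) * Ψ n θ)
      ((((-θ) ^ M / M.factorial : ℝ) : ℂ) * Ψ (M + 1) θ) θ := by
    intro M θ hθ
    induction M with
    | zero => simpa using hd 0 θ hθ
    | succ M ih =>
      simp_rw [Finset.sum_range_succ _ (M + 1)]
      refine (ih.add ((hmon M θ).mul (hd (M + 1) θ hθ))).congr_deriv ?_
      ring
  have key := intervalIntegral.integral_eq_sub_of_hasDerivAt_of_le hb
    (f := fun θ => ∑ n ∈ Finset.range (M + 1), (((-θ) ^ n / n.factorial : ℝ) : ℂ) * Ψ n θ)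
    (continuousOn_finsetSum _ fun n _ => (hpc n).continuousOn.mul (hc n)) (hder M)
    (((hpc M).continuousOn.mul (hc (M + 1))).intervalIntegrable_of_Icc hb)
  rw [key, sub_sub_cancel, Finset.sum_range_succ', Finset.sum_eq_zero]
  · simp
  · intro n _
    simp

/-- In Taylor's formula based at b, every term except the remainder lives at the angle b > 0. The
remainder carries the weight θ^M, which cancels the admitted growth, so dominated convergence
applies. The bound uniform in ε is what later yields continuity of the limit functional. -/
theorem exists_tendsto_of_taylor {b : ℝ} (hb : 0 < b) (hb1 : b ≤ 1) {Ψ : ℝ → ℕ → ℝ → ℂ} {B : ℕ → ℝ} {M : ℕ}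
    (hc : ∀ ε > 0, ∀ n, ContinuousOn (Ψ ε n) (Set.Icc 0 b))
    (hd : ∀ ε > 0, ∀ n, ∀ θ ∈ Set.Ioo 0 b, HasDerivAt (Ψ ε n) (Ψ ε (n + 1) θ) θ)
    (hbound : ∀ ε ∈ Set.Ioc (0 : ℝ) 1, ∀ n, ∀ θ ∈ Set.Ioc 0 b, θ ^ M * ‖Ψ ε n θ‖ ≤ B n)
    (hlim : ∀ n, ∀ θ ∈ Set.Ioc 0 b, ∃ c, Tendsto (fun ε => Ψ ε n θ) (𝓝[>] 0) (𝓝 c)) :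
    (∃ c, Tendsto (fun ε => Ψ ε 0 0) (𝓝[>] 0) (𝓝 c)) ∧
      ∀ ε ∈ Set.Ioc (0 : ℝ) 1, ‖Ψ ε 0 0‖ ≤
        ∑ n ∈ Finset.range (M + 1), (b ^ M)⁻¹ * B n + B (M + 1) := by
  have hIoc : ∀ᶠ ε : ℝ in 𝓝[>] 0, ε ∈ Set.Ioc (0 : ℝ) 1 := Ioc_mem_nhdsGT one_pos
  have hfac : ∀ n : ℕ, (1 : ℝ) ≤ n.factorial := fun n => by exact_mod_cast Nat.one_le_iff_ne_zero.2 n.factorial_ne_zero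
  have hrem : ∀ ε ∈ Set.Ioc (0 : ℝ) 1, ∀ θ ∈ Set.uIoc 0 b,
      ‖(((-θ) ^ M / M.factorial : ℝ) : ℂ) * Ψ ε (M + 1) θ‖ ≤ B (M + 1) := by
    intro ε hε θ hθ
    rw [Set.uIoc_of_le hb.le] at hθ
    refine le_trans ?_ (hbound ε hε (M + 1) θ hθ)
    rw [norm_mul, Complex.norm_real, norm_div, norm_pow, norm_neg, Real.norm_of_nonneg hθ.1.le,
      Real.norm_of_nonneg (zero_le_one.trans (hfac M))]
    gcongr
    exact div_le_self (pow_nonneg hθ.1.le _) (hfac M)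
  constructor
  · choose! c hcl using hlim
    have h1 : Tendsto (fun ε => ∫ θ in (0 : ℝ)..b, (((-θ) ^ M / M.factorial : ℝ) : ℂ) * Ψ ε (M + 1) θ)
        (𝓝[>] 0) (𝓝 (∫ θ in (0 : ℝ)..b, (((-θ) ^ M / M.factorial : ℝ) : ℂ) * c (M + 1) θ)) := by
      refine intervalIntegral.tendsto_integral_filter_of_dominated_convergence (fun _ => B (M + 1))
        ?_ ?_ (by simp) ?_
      · filter_upwards [hIoc] with ε hε
        refine ContinuousOn.aestronglyMeasurable ?_ measurableSet_uIoc
        rw [Set.uIoc_of_le hb.le]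
        refine ContinuousOn.mul (Continuous.continuousOn (by fun_prop)) ?_
        exact (hc ε hε.1 (M + 1)).mono Set.Ioc_subset_Icc_self
      · filter_upwards [hIoc] with ε hε
        exact Eventually.of_forall (hrem ε hε)
      · refine Eventually.of_forall fun θ hθ => ?_
        rw [Set.uIoc_of_le hb.le] at hθ
        exact (hcl (M + 1) θ hθ).const_mul _
    have h2 := (tendsto_finsetSum (Finset.range (M + 1)) fun n _ =>
      (hcl n b ⟨hb, le_rfl⟩).const_mul (((-b) ^ n / n.factorial : ℝ) : ℂ)).sub h1
    refine ⟨_, h2.congr' ?_⟩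
    filter_upwards [hIoc] with ε hε
    exact (taylor_from_endpoint hb.le (hc ε hε.1) (hd ε hε.1) M).symm
  · intro ε hε
    rw [taylor_from_endpoint hb.le (hc ε hε.1) (hd ε hε.1) M]
    refine (norm_sub_le _ _).trans (add_le_add ?_ ?_)
    · refine (norm_sum_le _ _).trans (Finset.sum_le_sum fun n _ => ?_)
      have h := hbound ε hε n b ⟨hb, le_rfl⟩
      rw [norm_mul, Complex.norm_real, norm_div, norm_pow, norm_neg, Real.norm_of_nonneg hb.le,
        Real.norm_of_nonneg (zero_le_one.trans (hfac n))]
      have h1 : b ^ n / n.factorial ≤ 1 :=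
        (div_le_self (pow_nonneg hb.le _) (hfac n)).trans (pow_le_one₀ hb.le hb1)
      refine (mul_le_of_le_one_left (norm_nonneg _) h1).trans ?_
      rw [inv_mul_eq_div, le_div_iff₀ (by positivity), mul_comm]
      exact h
    · have hB : 0 ≤ B (M + 1) := le_trans (by positivity) (hbound ε hε (M + 1) b ⟨hb, le_rfl⟩)
      refine (intervalIntegral.norm_integral_le_of_norm_le_const (hrem ε hε)).trans ?_
      rw [sub_zero, abs_of_pos hb]
      exact mul_le_of_le_one_right hB hb1

/-! ### Kernels with a Wick rotation -/

/-- Kernels depending on a regulator `ε > 0` which extend analytically to all Wick rotated tuples, with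
a power bound in the angle that is locally uniform off the diagonals, and which converge for positive
angles as `ε → 0`. -/
structure IsWickRotatable {n : ℕ} (k : ℝ → (Fin n → ℂ × ℂ) → ℂ) : Prop where
  analyticAt : ∀ ε > 0, ∀ θ ∈ Set.Icc 0 (Real.pi / 4), ∀ x, AnalyticAt ℂ (k ε) (wickTuple θ x)
  bound : ∃ M : ℕ, ∀ K : Set (Fin n → Mink), IsCompact K → K ⊆ offDiag n → ∃ C : ℝ,
    ∀ ε ∈ Set.Ioc (0 : ℝ) 1, ∀ θ ∈ Set.Ioc 0 (Real.pi / 4), ∀ x ∈ K,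
      θ ^ M * ‖k ε (wickTuple θ x)‖ ≤ C
  tendsto : ∀ θ ∈ Set.Ioc 0 (Real.pi / 4), ∀ x ∈ offDiag n,
    ∃ c, Tendsto (fun ε => k ε (wickTuple θ x)) (𝓝[>] 0) (𝓝 c)

theorem pi_div_four_le_one : Real.pi / 4 ≤ 1 := by linarith [Real.pi_le_four]

namespace IsWickRotatable

variable {n : ℕ} {k k' : ℝ → (Fin n → ℂ × ℂ) → ℂ}

theorem const (c : ℂ) : IsWickRotatable fun (_ : ℝ) (_ : Fin n → ℂ × ℂ) => c where
  analyticAt _ _ _ _ _ := analyticAt_const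
  bound := ⟨0, fun _ _ _ => ⟨‖c‖, fun _ _ _ _ _ _ => by simp⟩⟩
  tendsto _ _ _ _ := ⟨c, tendsto_const_nhds⟩

/-- The growth exponents in 1/θ add. Hence polynomials in propagators and their derivatives stay in
the class, which is how products of singular distributions are controlled. -/
theorem mul (hk : IsWickRotatable k) (hk' : IsWickRotatable k') :
    IsWickRotatable fun ε z => k ε z * k' ε z where
  analyticAt ε hε θ hθ x := (hk.analyticAt ε hε θ hθ x).mul (hk'.analyticAt ε hε θ hθ x)
  bound := by
    obtain ⟨M, hM⟩ := hk.bound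
    obtain ⟨M', hM'⟩ := hk'.bound
    refine ⟨M + M', fun K hK hKs => ?_⟩
    obtain ⟨C, hC⟩ := hM K hK hKs
    obtain ⟨C', hC'⟩ := hM' K hK hKs
    refine ⟨C * C', fun ε hε θ hθ x hx => ?_⟩
    have h := hC ε hε θ hθ x hx
    have h' := hC' ε hε θ hθ x hx
    have hθ0 := hθ.1
    rw [pow_add, norm_mul, mul_mul_mul_comm]
    exact mul_le_mul h h' (by positivity) (le_trans (by positivity) h)
  tendsto θ hθ x hx := by
    obtain ⟨c, hc⟩ := hk.tendsto θ hθ x hx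
    obtain ⟨c', hc'⟩ := hk'.tendsto θ hθ x hx
    exact ⟨_, hc.mul hc'⟩

theorem add (hk : IsWickRotatable k) (hk' : IsWickRotatable k') :
    IsWickRotatable fun ε z => k ε z + k' ε z where
  analyticAt ε hε θ hθ x := (hk.analyticAt ε hε θ hθ x).add (hk'.analyticAt ε hε θ hθ x)
  bound := by
    obtain ⟨M, hM⟩ := hk.bound
    obtain ⟨M', hM'⟩ := hk'.bound
    refine ⟨M + M', fun K hK hKs => ?_⟩
    obtain ⟨C, hC⟩ := hM K hK hKs
    obtain ⟨C', hC'⟩ := hM' K hK hKs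
    refine ⟨C + C', fun ε hε θ hθ x hx => ?_⟩
    have hθ0 := hθ.1
    have hθ1 : θ ≤ 1 := hθ.2.trans pi_div_four_le_one
    calc θ ^ (M + M') * ‖k ε (wickTuple θ x) + k' ε (wickTuple θ x)‖
        ≤ θ ^ (M + M') * (‖k ε (wickTuple θ x)‖ + ‖k' ε (wickTuple θ x)‖) := by
          gcongr
          exact norm_add_le _ _
      _ = θ ^ (M + M') * ‖k ε (wickTuple θ x)‖ + θ ^ (M + M') * ‖k' ε (wickTuple θ x)‖ := mul_add _ _ _
      _ ≤ θ ^ M * ‖k ε (wickTuple θ x)‖ + θ ^ M' * ‖k' ε (wickTuple θ x)‖ := by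
          gcongr ?_ * _ + ?_ * _
          · exact pow_le_pow_of_le_one hθ0.le hθ1 (Nat.le_add_right _ _)
          · exact pow_le_pow_of_le_one hθ0.le hθ1 (Nat.le_add_left _ _)
      _ ≤ C + C' := add_le_add (hC ε hε θ hθ x hx) (hC' ε hε θ hθ x hx)
  tendsto θ hθ x hx := by
    obtain ⟨c, hc⟩ := hk.tendsto θ hθ x hx
    obtain ⟨c', hc'⟩ := hk'.tendsto θ hθ x hx
    exact ⟨_, hc.add hc'⟩

theorem sum {ι : Type*} (s : Finset ι) {k : ι → ℝ → (Fin n → ℂ × ℂ) → ℂ}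
    (hk : ∀ i ∈ s, IsWickRotatable (k i)) : IsWickRotatable fun ε z => ∑ i ∈ s, k i ε z := by
  classical
  induction s using Finset.induction_on with
  | empty => simpa using const 0
  | insert i s hi ih =>
    simp_rw [Finset.sum_insert hi]
    exact (hk i (Finset.mem_insert_self i s)).add
      (ih fun j hj => hk j (Finset.mem_insert_of_mem hj))

theorem prod {ι : Type*} (s : Finset ι) {k : ι → ℝ → (Fin n → ℂ × ℂ) → ℂ}
    (hk : ∀ i ∈ s, IsWickRotatable (k i)) : IsWickRotatable fun ε z => ∏ i ∈ s, k i ε z := by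
  classical
  induction s using Finset.induction_on with
  | empty => simpa using const 1
  | insert i s hi ih =>
    simp_rw [Finset.prod_insert hi]
    exact (hk i (Finset.mem_insert_self i s)).mul
      (ih fun j hj => hk j (Finset.mem_insert_of_mem hj))

theorem pow (hk : IsWickRotatable k) (m : ℕ) : IsWickRotatable fun ε z => k ε z ^ m := by
  have := prod (Finset.range m) (k := fun _ => k) fun _ _ => hk
  simpa using this

theorem contDiff (hk : IsWickRotatable k) {ε : ℝ} (hε : 0 < ε) {θ : ℝ}
    (hθ : θ ∈ Set.Icc 0 (Real.pi / 4)) : ContDiff ℝ 1 fun x => k ε (wickTuple θ x) := by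
  refine contDiff_iff_contDiffAt.2 fun x => ?_
  exact ((hk.analyticAt ε hε θ hθ x).restrictScalars (𝕜 := ℝ)).contDiffAt.comp x
    (wickTuple θ).contDiff.contDiffAt

/-- Because the rotation is linear in x, the real derivative along the boost is the same complex
derivative that occurs in `IsWickRotatable.hasDerivAt_wickTuple`; the two differ only by the factor
i. -/
theorem fderiv_boost (hk : IsWickRotatable k) {ε : ℝ} (hε : 0 < ε) {θ : ℝ}
    (hθ : θ ∈ Set.Icc 0 (Real.pi / 4)) (x : Fin n → Mink) :
    fderiv ℝ (fun x => k ε (wickTuple θ x)) x (boost x) =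
      fderiv ℂ (k ε) (wickTuple θ x) (wickTuple θ (boost x)) := by
  have h := (hk.analyticAt ε hε θ hθ x).differentiableAt.hasFDerivAt.restrictScalars ℝ
  have h' : HasFDerivAt (fun x => k ε (wickTuple θ x)) _ x := h.comp x (wickTuple θ).hasFDerivAt
  rw [h'.fderiv]
  rfl

theorem hasDerivAt_wickTuple (hk : IsWickRotatable k) {ε : ℝ} (hε : 0 < ε) {θ : ℝ}
    (hθ : θ ∈ Set.Icc 0 (Real.pi / 4)) (x : Fin n → Mink) :
    HasDerivAt (fun t => k ε (wickTuple t x))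
      (Complex.I * fderiv ℂ (k ε) (wickTuple θ x) (wickTuple θ (boost x))) θ := by
  have h := (hk.analyticAt ε hε θ hθ x).differentiableAt.hasFDerivAt.restrictScalars ℝ
  refine (h.comp_hasDerivAt θ (SineGordon.hasDerivAt_wickTuple θ x)).congr_deriv ?_
  simp

theorem continuousOn_uncurry (hk : IsWickRotatable k) {ε : ℝ} (hε : 0 < ε) :
    ContinuousOn (fun p : ℝ × (Fin n → Mink) => k ε (wickTuple p.1 p.2))
      (Set.Icc 0 (Real.pi / 4) ×ˢ Set.univ) := by
  rintro ⟨θ, x⟩ hp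
  have h : Tendsto (fun p : ℝ × (Fin n → Mink) => wickTuple p.1 p.2) (𝓝 (θ, x))
    (𝓝 (wickTuple θ x)) := continuous_wickTuple_uncurry.tendsto (θ, x)
  exact ((hk.analyticAt ε hε θ hp.1 x).continuousAt.tendsto.comp h).mono_left nhdsWithin_le_nhds

theorem continuousOn_fderiv_uncurry (hk : IsWickRotatable k) {ε : ℝ} (hε : 0 < ε) :
    ContinuousOn (fun p : ℝ × (Fin n → Mink) =>
        fderiv ℂ (k ε) (wickTuple p.1 p.2) (wickTuple p.1 (boost p.2)))
      (Set.Icc 0 (Real.pi / 4) ×ˢ Set.univ) := by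
  rintro ⟨θ, x⟩ hp
  have h : Tendsto (fun p : ℝ × (Fin n → Mink) => wickTuple p.1 p.2) (𝓝 (θ, x))
    (𝓝 (wickTuple θ x)) := continuous_wickTuple_uncurry.tendsto (θ, x)
  have h' : Continuous fun p : ℝ × (Fin n → Mink) => wickTuple p.1 (boost p.2) :=
    continuous_wickTuple_uncurry.comp
      (continuous_fst.prodMk (boost.continuous.comp continuous_snd))
  have h1 : ContinuousAt (fun p : ℝ × (Fin n → Mink) => fderiv ℂ (k ε) (wickTuple p.1 p.2)) (θ, x) :=
    (hk.analyticAt ε hε θ hp.1 x).fderiv.continuousAt.tendsto.comp h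
  exact (h1.clm_apply h'.continuousAt).continuousWithinAt

end IsWickRotatable

/-! ### Boundary values of Wick rotatable kernels -/

open ContDiffMapSupportedIn in
/-- The derivative of test functions along the boosts. -/
def boostDeriv {n : ℕ} (K : TopologicalSpace.Compacts (Fin n → Mink)) :
    𝓓_{K}(Fin n → Mink, ℂ) →L[ℝ] 𝓓_{K}(Fin n → Mink, ℂ) :=
  (bilinLeftCLM (𝕜 := ℝ) (ContinuousLinearMap.id ℝ ((Fin n → Mink) →L[ℝ] ℂ))
    (boost (n := n)).contDiff).comp (fderivCLM ℝ ⊤ ⊤)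

theorem boostDeriv_apply {n : ℕ} {K : TopologicalSpace.Compacts (Fin n → Mink)}
    (g : 𝓓_{K}(Fin n → Mink, ℂ)) (x : Fin n → Mink) :
    boostDeriv K g x = fderiv ℝ g x (boost x) := by
  simp [boostDeriv]

namespace IsWickRotatable

variable {n : ℕ} {k : ℝ → (Fin n → ℂ × ℂ) → ℂ} {K : TopologicalSpace.Compacts (Fin n → Mink)}

/-- The θ-derivative of the kernel is i times its boost derivative, and antisymmetry of the boost
moves that derivative to `g` with a minus sign. The result has the original form, so the step can be
iterated. -/
theorem hasDerivAt_integral (hk : IsWickRotatable k) {ε : ℝ} (hε : 0 < ε) {θ : ℝ}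
    (hθ : θ ∈ Set.Ioo 0 (Real.pi / 4)) (g : 𝓓_{K}(Fin n → Mink, ℂ)) :
    HasDerivAt (fun t => ∫ x, k ε (wickTuple t x) * g x)
      (-Complex.I * ∫ x, k ε (wickTuple θ x) * boostDeriv K g x) θ := by
  have hθ' := Set.Ioo_subset_Icc_self hθ
  have hcK : ∀ t ∈ Set.Icc 0 (Real.pi / 4), Continuous fun x => k ε (wickTuple t x) :=
    fun t ht => (hk.contDiff hε ht).continuous
  have hg1 : ContDiff ℝ 1 g := g.contDiff.of_le (by simp)
  have hd : ContinuousOn (fun p : ℝ × (Fin n → Mink) =>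
      Complex.I * fderiv ℂ (k ε) (wickTuple p.1 p.2) (wickTuple p.1 (boost p.2)) * g p.2)
      (Set.Icc 0 (Real.pi / 4) ×ˢ Set.univ) :=
    (continuousOn_const.mul (hk.continuousOn_fderiv_uncurry hε)).mul
      (g.continuous.comp continuous_snd).continuousOn
  obtain ⟨C, hC⟩ := (isCompact_Icc.prod K.isCompact).exists_bound_of_continuousOn
    (hd.mono (Set.prod_mono_right (Set.subset_univ _)))
  have hcf : Continuous fun x => Complex.I * fderiv ℂ (k ε) (wickTuple θ x) (wickTuple θ (boost x)) * g x :=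
    hd.comp_continuous (f := fun x : Fin n → Mink => (θ, x)) (by fun_prop) fun x => ⟨hθ', trivial⟩
  have h := hasDerivAt_integral_of_dominated_loc_of_deriv_le (μ := (volume : Measure (Fin n → Mink)))
    (F := fun t x => k ε (wickTuple t x) * g x) (x₀ := θ)
    (F' := fun t x => Complex.I * fderiv ℂ (k ε) (wickTuple t x) (wickTuple t (boost x)) * g x)
    (bound := (K : Set (Fin n → Mink)).indicator fun _ => C)
    (s := Set.Ioo 0 (Real.pi / 4)) (Ioo_mem_nhds hθ.1 hθ.2) ?_ ?_ ?_ ?_ ?_ ?_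
  · refine h.2.congr_deriv ?_
    have h1 := integral_fderiv_boost_mul (hk.contDiff hε hθ') hg1 g.hasCompactSupport
    simp_rw [hk.fderiv_boost hε hθ'] at h1
    simp_rw [boostDeriv_apply, mul_assoc]
    rw [integral_const_mul, h1]
    ring
  · filter_upwards [Ioo_mem_nhds hθ.1 hθ.2] with t ht
    exact ((hcK t (Set.Ioo_subset_Icc_self ht)).mul g.continuous).aestronglyMeasurable
  · exact ((hcK θ hθ').mul g.continuous).integrable_of_hasCompactSupport g.hasCompactSupport.mul_left
  · exact hcf.aestronglyMeasurable
  · refine Eventually.of_forall fun x t ht => ?_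
    by_cases hx : x ∈ K
    · rw [Set.indicator_of_mem hx]
      exact hC (t, x) ⟨Set.Ioo_subset_Icc_self ht, hx⟩
    · rw [Set.indicator_of_notMem hx, g.zero_on_compl hx]
      simp
  · rw [integrable_indicator_iff K.isCompact.measurableSet]
    exact integrableOn_const K.isCompact.measure_ne_top
  · refine Eventually.of_forall fun x t ht => ?_
    exact (hk.hasDerivAt_wickTuple hε (Set.Ioo_subset_Icc_self ht) x).mul_const _

theorem continuousOn_integral (hk : IsWickRotatable k) {ε : ℝ} (hε : 0 < ε)
    (g : 𝓓_{K}(Fin n → Mink, ℂ)) :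
    ContinuousOn (fun t => ∫ x, k ε (wickTuple t x) * g x) (Set.Icc 0 (Real.pi / 4)) := by
  refine continuousOn_integral_of_compact_support K.isCompact ?_ ?_
  · exact (hk.continuousOn_uncurry hε).mul (g.continuous.comp continuous_snd).continuousOn
  · intro t x _ hx
    rw [g.zero_on_compl hx]
    simp

/-- Test functions have convergent and uniformly bounded integrals against a Wick rotatable kernel. -/
theorem exists_tendsto_integral (hk : IsWickRotatable k)
    (hK : (K : Set (Fin n → Mink)) ⊆ offDiag n) :
    ∃ p : 𝓓_{K}(Fin n → Mink, ℂ) → ℝ, Continuous p ∧ p 0 = 0 ∧ ∀ g, ∃ c,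
      Tendsto (fun ε => ∫ x, k ε (wickTuple 0 x) * g x) (𝓝[>] 0) (𝓝 c) ∧ ‖c‖ ≤ p g := by
  obtain ⟨M, hM⟩ := hk.bound
  obtain ⟨C, hC⟩ := hM K K.isCompact hK
  have hb : (0 : ℝ) < Real.pi / 4 := by positivity
  let V : ℝ := volume.real (K : Set (Fin n → Mink))
  let N : 𝓓_{K}(Fin n → Mink, ℂ) → ℝ := fun g => ‖ContDiffMapSupportedIn.toBoundedContinuousFunctionCLM ℝ g‖
  have hN : ∀ (g : 𝓓_{K}(Fin n → Mink, ℂ)) x, ‖g x‖ ≤ N g := fun g x =>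
    BoundedContinuousFunction.norm_coe_le_norm (ContDiffMapSupportedIn.toBoundedContinuousFunctionCLM ℝ g) x
  have hNc : Continuous N := (ContinuousLinearMap.continuous _).norm
  let B : 𝓓_{K}(Fin n → Mink, ℂ) → ℕ → ℝ := fun g m => |C| * N ((boostDeriv K)^[m] g) * V
  have hBc : ∀ m, Continuous fun g => B g m := fun m =>
    (continuous_const.mul (hNc.comp ((boostDeriv K).continuous.iterate m))).mul continuous_const
  have hB0 : ∀ m, B 0 m = 0 := by
    intro m
    have : (boostDeriv K)^[m] 0 = 0 := Function.iterate_fixed (map_zero _) m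
    have hN0 : N 0 = 0 := by simp only [N, map_zero, norm_zero]
    simp [B, this, hN0]
  -- This is the bound of `exists_tendsto_of_taylor` with b = π/4. It is continuous in `g` because
  -- `boostDeriv` is continuous on test functions supported in K; continuity and the value 0 at 0
  -- suffice, since the limit will be linear in `g`.
  refine ⟨fun g => ∑ m ∈ Finset.range (M + 1), ((Real.pi / 4) ^ M)⁻¹ * B g m + B g (M + 1),
    (continuous_finsetSum _ fun m _ => continuous_const.mul (hBc m)).add (hBc _), by simp [hB0], ?_⟩
  intro g
  -- The m-th θ-derivative of the integral: each differentiation costs a factor -i and one boost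
  -- derivative of the test function.
  let Ψ : ℝ → ℕ → ℝ → ℂ := fun ε m θ =>
    (-Complex.I) ^ m * ∫ x, k ε (wickTuple θ x) * ((boostDeriv K)^[m] g) x
  have hpow : ∀ m : ℕ, ‖(-Complex.I) ^ m‖ = 1 := by simp
  have hpt : ∀ ε ∈ Set.Ioc (0 : ℝ) 1, ∀ m, ∀ θ ∈ Set.Ioc 0 (Real.pi / 4), ∀ x ∈ K,
      ‖k ε (wickTuple θ x) * ((boostDeriv K)^[m] g) x‖ ≤
        (θ ^ M)⁻¹ * (|C| * N ((boostDeriv K)^[m] g)) := by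
    intro ε hε m θ hθ x hx
    have hθ0 := hθ.1
    rw [norm_mul, ← mul_assoc]
    gcongr
    · rw [inv_mul_eq_div, le_div_iff₀ (by positivity), mul_comm]
      exact (hC ε hε θ hθ x hx).trans (le_abs_self C)
    · exact hN _ x
  have hset : ∀ ε m θ, ∫ x, k ε (wickTuple θ x) * ((boostDeriv K)^[m] g) x =
      ∫ x in K, k ε (wickTuple θ x) * ((boostDeriv K)^[m] g) x := by
    intro ε m θ
    rw [setIntegral_eq_integral_of_forall_compl_eq_zero]
    intro x hx
    rw [((boostDeriv K)^[m] g).zero_on_compl hx]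
    simp
  have key := exists_tendsto_of_taylor (b := Real.pi / 4) hb pi_div_four_le_one (Ψ := Ψ) (B := B g) (M := M)
    ?_ ?_ ?_ ?_
  · obtain ⟨⟨c, hc⟩, hbd⟩ := key
    refine ⟨c, by simpa [Ψ] using hc, ?_⟩
    refine le_of_tendsto hc.norm ?_
    filter_upwards [Ioc_mem_nhdsGT (one_pos (α := ℝ))] with ε hε
    exact hbd ε hε
  · exact fun ε hε m => continuousOn_const.mul (hk.continuousOn_integral hε _)
  · intro ε hε m θ hθ
    refine ((hk.hasDerivAt_integral hε hθ ((boostDeriv K)^[m] g)).const_mul _).congr_deriv ?_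
    simp only [Ψ, Function.iterate_succ_apply', pow_succ]
    ring
  · intro ε hε m θ hθ
    have hθ0 := hθ.1
    simp only [Ψ]
    rw [norm_mul, hpow, one_mul, hset]
    have h := norm_setIntegral_le_of_norm_le_const (μ := (volume : Measure (Fin n → Mink)))
      K.isCompact.measure_lt_top (hpt ε hε m θ hθ)
    calc θ ^ M * ‖∫ x in K, k ε (wickTuple θ x) * ((boostDeriv K)^[m] g) x‖
        ≤ θ ^ M * ((θ ^ M)⁻¹ * (|C| * N ((boostDeriv K)^[m] g)) * V) := by gcongr
      _ = B g m := by
        have : θ ^ M ≠ 0 := by positivity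
        simp only [B]
        field_simp
  · intro m θ hθ
    have hlim := hk.tendsto θ hθ
    choose! c hc using hlim
    refine ⟨(-Complex.I) ^ m * ∫ x in K, c x * ((boostDeriv K)^[m] g) x, Tendsto.const_mul _ ?_⟩
    simp_rw [hset]
    refine tendsto_integral_filter_of_dominated_convergence
      (fun _ => (θ ^ M)⁻¹ * (|C| * N ((boostDeriv K)^[m] g))) ?_ ?_ ?_ ?_
    · filter_upwards [self_mem_nhdsWithin] with ε hε
      exact ((hk.contDiff hε ⟨hθ.1.le, hθ.2⟩).continuous.mul
        ((boostDeriv K)^[m] g).continuous).aestronglyMeasurable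
    · filter_upwards [Ioc_mem_nhdsGT (one_pos (α := ℝ))] with ε hε
      rw [ae_restrict_iff' K.isCompact.measurableSet]
      exact Eventually.of_forall fun x hx => hpt ε hε m θ hθ x hx
    · exact integrableOn_const K.isCompact.measure_ne_top
    · rw [ae_restrict_iff' K.isCompact.measurableSet]
      exact Eventually.of_forall fun x hx => (hc x (hK hx)).mul_const _

end IsWickRotatable

/-- A family of kernels which is continuous for `ε > 0` and has a boundary value. -/
def HasBoundaryValue {n : ℕ} (κ : ℝ → (Fin n → Mink) → ℂ) : Prop :=
  (∀ ε > 0, Continuous (κ ε)) ∧ ∃ u, IsBoundaryValue κ u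

-- The configuration is only smooth and has no extension to rotated arguments. Its contribution `b`
-- is therefore multiplied into the test function, and only the propagator part `k` is rotated. The
-- pointwise limits are linear in the test function, and their bound gives continuity at 0 on each
-- space of fixed compact support.
open ContDiffMapSupportedIn in
theorem IsWickRotatable.hasBoundaryValue {n : ℕ} {k : ℝ → (Fin n → ℂ × ℂ) → ℂ}
    (hk : IsWickRotatable k) {b : (Fin n → Mink) → ℂ} (hb : ContDiff ℝ ∞ b) :
    HasBoundaryValue fun ε x => b x * k ε (wickTuple 0 x) := by
  have h0 : (0 : ℝ) ∈ Set.Icc 0 (Real.pi / 4) := ⟨le_rfl, by positivity⟩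
  have hcont : ∀ ε > 0, Continuous fun x => b x * k ε (wickTuple 0 x) := fun ε hε =>
    hb.continuous.mul (hk.contDiff hε h0).continuous
  refine ⟨hcont, ?_⟩
  have hint : ∀ ε > 0, ∀ f : 𝓓(offDiag n, ℝ),
      Integrable fun x => b x * k ε (wickTuple 0 x) * (f x : ℂ) := fun ε hε f =>
    ((hcont ε hε).mul (Complex.continuous_ofReal.comp f.continuous)).integrable_of_hasCompactSupport
      (f.hasCompactSupport.comp_left (g := Complex.ofReal) Complex.ofReal_zero).mul_left
  let m : ∀ K : TopologicalSpace.Compacts (Fin n → Mink),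
      𝓓_{K}(Fin n → Mink, ℝ) →L[ℝ] 𝓓_{K}(Fin n → Mink, ℂ) := fun K =>
    bilinLeftCLM (𝕜 := ℝ) (ContinuousLinearMap.lsmul ℝ ℝ (E := ℂ)) hb
  have hm : ∀ K (f : 𝓓_{K}(Fin n → Mink, ℝ)) x, m K f x = f x * b x := by
    intro K f x
    simp [m]
  have hloc : ∀ K : TopologicalSpace.Compacts (Fin n → Mink), (K : Set (Fin n → Mink)) ⊆ offDiag n →
      ∃ p : 𝓓_{K}(Fin n → Mink, ℝ) → ℝ, Continuous p ∧ p 0 = 0 ∧ ∀ f, ∃ c,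
        Tendsto (fun ε => ∫ x, b x * k ε (wickTuple 0 x) * (f x : ℂ)) (𝓝[>] 0) (𝓝 c) ∧ ‖c‖ ≤ p f := by
    intro K hK
    obtain ⟨p, hp, hp0, hpc⟩ := hk.exists_tendsto_integral hK
    refine ⟨fun f => p (m K f), hp.comp (m K).continuous, by simp [hp0], fun f => ?_⟩
    obtain ⟨c, hc, hcp⟩ := hpc (m K f)
    refine ⟨c, hc.congr fun ε => integral_congr_ae (Eventually.of_forall fun x => ?_), hcp⟩
    simp only [hm]
    ring
  have hex : ∀ f : 𝓓(offDiag n, ℝ), ∃ c,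
      Tendsto (fun ε => ∫ x, b x * k ε (wickTuple 0 x) * (f x : ℂ)) (𝓝[>] 0) (𝓝 c) := by
    intro f
    obtain ⟨p, -, -, h⟩ := hloc ⟨tsupport f, f.hasCompactSupport⟩ f.tsupport_subset
    obtain ⟨c, hc, -⟩ := h (.of_support_subset f.contDiff subset_closure)
    exact ⟨c, hc⟩
  choose c hc using hex
  have hadd : ∀ f g, c (f + g) = c f + c g := by
    intro f g
    refine tendsto_nhds_unique (hc (f + g)) (((hc f).add (hc g)).congr' ?_)
    filter_upwards [self_mem_nhdsWithin] with ε hε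
    rw [← integral_add (hint ε hε f) (hint ε hε g)]
    refine integral_congr_ae (Eventually.of_forall fun x => ?_)
    simp only [FunLike.coe_add, Pi.add_apply, Complex.ofReal_add]
    ring
  have hsmul : ∀ (r : ℝ) f, c (r • f) = r • c f := by
    intro r f
    refine tendsto_nhds_unique (hc (r • f)) (((hc f).const_smul r).congr' ?_)
    filter_upwards [self_mem_nhdsWithin] with ε hε
    rw [← integral_smul]
    refine integral_congr_ae (Eventually.of_forall fun x => ?_)
    simp only [Complex.real_smul]
    simp
    ring
  refine ⟨TestFunction.mkCLM ℝ c hadd hsmul fun K hK => ?_, fun f => hc f⟩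
  obtain ⟨p, hp, hp0, h⟩ := hloc K hK
  have hle : ∀ f : 𝓓_{K}(Fin n → Mink, ℝ), ‖c (TestFunction.ofSupportedIn hK f)‖ ≤ p f := by
    intro f
    obtain ⟨d, hd, hdp⟩ := h f
    rwa [tendsto_nhds_unique (hc (TestFunction.ofSupportedIn hK f)) hd]
  let Φ : 𝓓_{K}(Fin n → Mink, ℝ) →ₗ[ℝ] ℂ :=
    { toFun := fun f => c (TestFunction.ofSupportedIn hK f)
      map_add' := fun f g => hadd (TestFunction.ofSupportedIn hK f) (TestFunction.ofSupportedIn hK g)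
      map_smul' := fun r f => hsmul r (TestFunction.ofSupportedIn hK f) }
  change Continuous Φ
  refine continuous_of_continuousAt_zero Φ ?_
  rw [ContinuousAt, map_zero]
  refine squeeze_zero_norm hle ?_
  simpa [hp0] using hp.tendsto 0

/-! ### Derivatives of the Feynman propagator -/

/-- The complexified regularised invariant square `4 τ ξ + iε`. -/
def regSq (ε : ℝ) (z : ℂ × ℂ) : ℂ := 4 * z.1 * z.2 + (ε : ℂ) * Complex.I

/-- The `m`-th `ξ`-derivative of the regularised Feynman propagator at complex arguments. -/
def propDeriv (μ : ℝ) (m : ℕ) (ε : ℝ) (z : ℂ × ℂ) : ℂ :=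
  -(1 / (4 * (Real.pi : ℂ))) *
    match m with
    | 0 => Complex.log ((μ : ℂ) ^ 2 * regSq ε z)
    | m + 1 => (-1) ^ m * (m.factorial : ℂ) * ((4 * z.1) ^ (m + 1) / regSq ε z ^ (m + 1))

/-- A point of the Minkowski plane as a point of its complexification. -/
def complexify (x : Mink) : ℂ × ℂ := (x.1, x.2)

theorem wickCLM_zero (x : Mink) : wickCLM 0 x = complexify x := by
  simp [wickCLM_apply, complexify]

theorem feynman_eq_propDeriv (μ ε : ℝ) (x : Mink) :
    feynman μ ε x = propDeriv μ 0 ε (complexify x) := by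
  simp [feynman, propDeriv, regSq, complexify, minkSq]

theorem mul_mem_slitPlane {μ : ℝ} (hμ : 0 < μ) {w : ℂ} (hw : 0 < w.im) :
    (μ : ℂ) ^ 2 * w ∈ Complex.slitPlane := by
  refine Or.inr ?_
  rw [← Complex.ofReal_pow, Complex.im_ofReal_mul]
  positivity

theorem ne_zero_of_im_pos {w : ℂ} (hw : 0 < w.im) : w ≠ 0 := by
  rintro rfl
  simp at hw

theorem regSq_complexify_im (ε : ℝ) (x : Mink) : (regSq ε (complexify x)).im = ε := by
  simp [regSq, complexify]

theorem continuous_propDeriv {μ : ℝ} (hμ : 0 < μ) (m : ℕ) {ε : ℝ} (hε : 0 < ε) :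
    Continuous fun x : Mink => propDeriv μ m ε (complexify x) := by
  have hreg : Continuous fun x : Mink => regSq ε (complexify x) := by
    unfold regSq complexify
    fun_prop
  have him : ∀ x : Mink, 0 < (regSq ε (complexify x)).im := fun x => by
    rwa [regSq_complexify_im]
  have h1 : Continuous fun x : Mink => (complexify x).1 := by
    unfold complexify
    fun_prop
  cases m with
  | zero =>
    exact continuous_const.mul ((continuous_const.mul hreg).clog fun x => mul_mem_slitPlane hμ (him x))
  | succ m =>
    exact continuous_const.mul (continuous_const.mul (((continuous_const.mul h1).pow _).div (hreg.pow _)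
      fun x => pow_ne_zero _ (ne_zero_of_im_pos (him x))))

theorem hasDerivAt_propDeriv {μ : ℝ} (hμ : 0 < μ) (m : ℕ) {ε : ℝ} (hε : 0 < ε) (x : Mink) :
    HasDerivAt (fun s : ℝ => propDeriv μ m ε (complexify (x.1, s)))
      (propDeriv μ (m + 1) ε (complexify x)) x.2 := by
  have hreg : HasDerivAt (fun s : ℝ => regSq ε (complexify (x.1, s))) (4 * (x.1 : ℂ)) x.2 := by
    have h := ((hasDerivAt_id x.2).ofReal_comp.const_mul (4 * (x.1 : ℂ))).add_const
      ((ε : ℂ) * Complex.I)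
    simpa [regSq, complexify] using h
  have him : 0 < (regSq ε (complexify x)).im := by rwa [regSq_complexify_im]
  have hne := ne_zero_of_im_pos him
  cases m with
  | zero =>
    have hμ' : (μ : ℂ) ≠ 0 := by exact_mod_cast hμ.ne'
    refine (((hreg.const_mul ((μ : ℂ) ^ 2)).clog_real (mul_mem_slitPlane hμ him)).const_mul
      (-(1 / (4 * (Real.pi : ℂ))))).congr_deriv ?_
    change -(1 / (4 * (Real.pi : ℂ))) * ((μ : ℂ) ^ 2 * (4 * (x.1 : ℂ)) /
      ((μ : ℂ) ^ 2 * regSq ε (complexify x))) = _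
    simp only [propDeriv, complexify]
    simp only [complexify] at hne
    field_simp
    simp only [zero_add, pow_one, Nat.factorial_zero, Nat.cast_one, mul_one]
    ring
  | succ m =>
    have hpow := (hreg.pow (m + 1)).inv (pow_ne_zero _ hne)
    refine (((hpow.const_mul ((4 * (x.1 : ℂ)) ^ (m + 1))).const_mul
      ((-1) ^ m * (m.factorial : ℂ))).const_mul (-(1 / (4 * (Real.pi : ℂ))))).congr_deriv ?_
    change -(1 / (4 * (Real.pi : ℂ))) * ((-1) ^ m * (m.factorial : ℂ) * ((4 * (x.1 : ℂ)) ^ (m + 1) *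
      (-(((m + 1 : ℕ) : ℂ) * regSq ε (complexify x) ^ m * (4 * (x.1 : ℂ))) /
        (regSq ε (complexify x) ^ (m + 1)) ^ 2))) = _
    simp only [propDeriv, complexify, Nat.factorial_succ, Nat.cast_mul]
    simp only [complexify] at hne
    field_simp
    ring

/-- This is why the rotation works: the imaginary part is ε plus a positive multiple of the
Euclidean square once 0 < θ ≤ π/4. The expression is even in x, so the sign is the same for all
differences, whatever their causal relation or orientation. -/
theorem regSq_wickCLM (ε θ : ℝ) (x : Mink) :
    regSq ε (wickCLM θ x) = ((4 * (Real.cos θ ^ 2 - Real.sin θ ^ 2) * x.1 * x.2 : ℝ) : ℂ) +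
      ((4 * Real.cos θ * Real.sin θ * (x.1 ^ 2 + x.2 ^ 2) + ε : ℝ) : ℂ) * Complex.I := by
  rw [regSq, wickCLM_apply]
  push_cast
  linear_combination (4 * (Complex.sin θ) ^ 2 * x.1 * x.2) * Complex.I_sq

theorem regSq_wickCLM_im (ε θ : ℝ) (x : Mink) :
    (regSq ε (wickCLM θ x)).im =
      4 * Real.cos θ * Real.sin θ * (x.1 ^ 2 + x.2 ^ 2) + ε := by
  rw [regSq_wickCLM, Complex.add_im, Complex.ofReal_im, Complex.im_ofReal_mul, Complex.I_im]
  ring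

/-- Jordan-type bounds give cos θ ≥ 1/2 and sin θ ≥ θ/2 on this interval. Linear growth of the
imaginary part makes the singularity in θ at most a power. -/
theorem le_cos_mul_sin {θ : ℝ} (hθ : θ ∈ Set.Icc 0 (Real.pi / 4)) :
    θ ≤ 4 * Real.cos θ * Real.sin θ := by
  have hpi := Real.pi_pos
  have h1 : 2 / Real.pi * θ ≤ Real.sin θ := Real.mul_le_sin hθ.1 (by linarith [hθ.2])
  have h2 : 1 - 2 / Real.pi * θ ≤ Real.cos θ := Real.one_sub_mul_le_cos hθ.1 (by linarith [hθ.2])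
  have h3 : 2 / Real.pi * θ ≤ 1 / 2 := by
    rw [div_mul_eq_mul_div, div_le_iff₀ hpi]
    linarith [hθ.2]
  have h4 : θ / 2 ≤ 2 / Real.pi * θ := by
    rw [div_mul_eq_mul_div, div_le_div_iff₀ two_pos hpi]
    nlinarith [hθ.1, Real.pi_le_four]
  have h5 : 1 / 2 ≤ Real.cos θ := by linarith
  nlinarith [hθ.1]

theorem norm_wickCLM_le (θ : ℝ) (x : Mink) :
    ‖(wickCLM θ x).1‖ ≤ 2 * ‖x‖ ∧ ‖(wickCLM θ x).2‖ ≤ 2 * ‖x‖ := by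
  have h1 : ‖x.1‖ ≤ ‖x‖ := norm_fst_le x
  have h2 : ‖x.2‖ ≤ ‖x‖ := norm_snd_le x
  have hc := Real.abs_cos_le_one θ
  have hs := Real.abs_sin_le_one θ
  have key : ∀ a b : ℝ, ‖a‖ ≤ ‖x‖ → ‖b‖ ≤ ‖x‖ →
      ‖(Real.cos θ : ℂ) * a + Complex.I * Real.sin θ * b‖ ≤ 2 * ‖x‖ := by
    intro a b ha hb
    refine (norm_add_le _ _).trans ?_
    simp only [norm_mul, Complex.norm_real, Complex.norm_I, one_mul]
    rw [two_mul]
    exact add_le_add ((mul_le_of_le_one_left (norm_nonneg _) hc).trans ha)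
      ((mul_le_of_le_one_left (norm_nonneg _) hs).trans hb)
  rw [wickCLM_apply]
  exact ⟨key _ _ h1 h2, key _ _ h2 h1⟩

/-- A crude power bound, so that the logarithm is treated on the same footing as its derivatives. -/
theorem norm_log_le {w : ℂ} (hw : w ≠ 0) : ‖Complex.log w‖ ≤ ‖w‖ + ‖w‖⁻¹ + Real.pi := by
  have hpos : 0 < ‖w‖ := norm_pos_iff.2 hw
  have h1 := Real.log_le_sub_one_of_pos hpos
  have h2 := Real.log_le_sub_one_of_pos (inv_pos.2 hpos)
  rw [Real.log_inv] at h2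
  have h3 := inv_pos.2 hpos
  refine (Complex.norm_le_abs_re_add_abs_im _).trans (add_le_add ?_ ?_)
  · rw [Complex.log_re, abs_le]
    constructor <;> linarith
  · rw [Complex.log_im]
    exact Complex.abs_arg_le_pi w

theorem isWickRotatable_propDeriv {n : ℕ} {μ : ℝ} (hμ : 0 < μ) (m : ℕ) {i j : Fin n} (hij : i ≠ j) :
    IsWickRotatable fun ε (z : Fin n → ℂ × ℂ) => propDeriv μ m ε (z i - z j) where
  analyticAt ε hε θ hθ x := by
    have hc : 0 ≤ Real.cos θ * Real.sin θ := mul_nonneg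
      (Real.cos_nonneg_of_mem_Icc ⟨by linarith [hθ.1, Real.pi_pos], by linarith [hθ.2, Real.pi_pos]⟩)
      (Real.sin_nonneg_of_mem_Icc ⟨hθ.1, by linarith [hθ.2, Real.pi_pos]⟩)
    have him : 0 < (regSq ε (wickTuple θ x i - wickTuple θ x j)).im := by
      rw [wickTuple_apply, wickTuple_apply, ← map_sub, regSq_wickCLM_im]
      nlinarith [mul_nonneg hc (add_nonneg (sq_nonneg (x i - x j).1) (sq_nonneg (x i - x j).2))]
    let d : (Fin n → ℂ × ℂ) →L[ℂ] ℂ × ℂ :=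
      (ContinuousLinearMap.proj i : (Fin n → ℂ × ℂ) →L[ℂ] ℂ × ℂ) - ContinuousLinearMap.proj j
    have h1 : AnalyticAt ℂ (fun z : Fin n → ℂ × ℂ => (z i - z j).1) (wickTuple θ x) :=
      ((ContinuousLinearMap.fst ℂ ℂ ℂ).comp d).analyticAt _
    have h2 : AnalyticAt ℂ (fun z : Fin n → ℂ × ℂ => (z i - z j).2) (wickTuple θ x) :=
      ((ContinuousLinearMap.snd ℂ ℂ ℂ).comp d).analyticAt _
    have hreg : AnalyticAt ℂ (fun z : Fin n → ℂ × ℂ => regSq ε (z i - z j)) (wickTuple θ x) :=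
      ((analyticAt_const.mul h1).mul h2).add analyticAt_const
    cases m with
    | zero =>
      exact analyticAt_const.mul ((analyticAt_const.mul hreg).clog (mul_mem_slitPlane hμ him))
    | succ m =>
      exact analyticAt_const.mul (analyticAt_const.mul (((analyticAt_const.mul h1).pow _).div
        (hreg.pow _) (pow_ne_zero _ (ne_zero_of_im_pos him))))
  bound := by
    -- The logarithm costs one power of 1/θ through `norm_log_le`, the derivative of order m ≥ 1
    -- costs m powers; the exponent m + 1 covers both. The constant `δ` below is the minimal squared
    -- Euclidean distance of the two points over K, positive because K avoids the diagonals.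
    refine ⟨m + 1, fun K hK hKs => ?_⟩
    have hdist : Continuous fun x : Fin n → Mink => (x i - x j).1 ^ 2 + (x i - x j).2 ^ 2 := by
      fun_prop
    obtain ⟨δ, hδ, hδK⟩ : ∃ δ > 0, ∀ x ∈ K, δ ≤ (x i - x j).1 ^ 2 + (x i - x j).2 ^ 2 := by
      rcases K.eq_empty_or_nonempty with rfl | hne
      · exact ⟨1, one_pos, by simp⟩
      · obtain ⟨y, hy, hmin⟩ := hK.exists_isMinOn hne hdist.continuousOn
        refine ⟨_, ?_, fun x hx => hmin hx⟩
        have hyij : y i - y j ≠ 0 := sub_ne_zero.2 ((hKs hy).ne hij)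
        by_contra hle
        refine hyij (Prod.ext ?_ ?_)
        · exact pow_eq_zero_iff two_ne_zero |>.1 (by
            nlinarith [sq_nonneg (y i - y j).1, sq_nonneg (y i - y j).2])
        · exact pow_eq_zero_iff two_ne_zero |>.1 (by
            nlinarith [sq_nonneg (y i - y j).1, sq_nonneg (y i - y j).2])
    obtain ⟨R, hR⟩ := hK.exists_bound_of_continuousOn
      (f := fun x : Fin n → Mink => x i - x j) (by fun_prop)
    have hmain : ∀ ε ∈ Set.Ioc (0 : ℝ) 1, ∀ θ ∈ Set.Ioc 0 (Real.pi / 4), ∀ x ∈ K,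
        θ * δ ≤ ‖regSq ε (wickCLM θ (x i - x j))‖ ∧
        ‖regSq ε (wickCLM θ (x i - x j))‖ ≤ 16 * R ^ 2 + 1 ∧
        ‖4 * (wickCLM θ (x i - x j)).1‖ ≤ 8 * R := by
      intro ε hε θ hθ x hx
      have hRx := hR x hx
      obtain ⟨hw1, hw2⟩ := norm_wickCLM_le θ (x i - x j)
      have hR0 : 0 ≤ R := (norm_nonneg _).trans hRx
      refine ⟨?_, ?_, ?_⟩
      · refine le_trans ?_ ((le_abs_self _).trans (Complex.abs_im_le_norm _))
        rw [regSq_wickCLM_im]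
        have := mul_le_mul (le_cos_mul_sin ⟨hθ.1.le, hθ.2⟩) (hδK x hx) hδ.le
          (hθ.1.le.trans (le_cos_mul_sin ⟨hθ.1.le, hθ.2⟩))
        linarith [hε.1]
      · rw [regSq]
        refine (norm_add_le _ _).trans (add_le_add ?_ ?_)
        · rw [norm_mul, norm_mul]
          have : ‖(wickCLM θ (x i - x j)).1‖ * ‖(wickCLM θ (x i - x j)).2‖ ≤ (2 * R) * (2 * R) :=
            mul_le_mul (hw1.trans (by linarith)) (hw2.trans (by linarith)) (norm_nonneg _)
              (by positivity)
          have h4 : ‖(4 : ℂ)‖ = 4 := by simp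
          rw [h4]
          nlinarith
        · rw [norm_mul, Complex.norm_I, mul_one, Complex.norm_real, Real.norm_of_nonneg hε.1.le]
          exact hε.2
      · rw [norm_mul]
        have h4 : ‖(4 : ℂ)‖ = 4 := by simp
        rw [h4]
        linarith
    have hpi : ‖-(1 / (4 * (Real.pi : ℂ)))‖ ≤ 1 := by
      rw [norm_neg, norm_div, norm_mul, Complex.norm_real, Real.norm_of_nonneg Real.pi_pos.le]
      simp only [norm_one, Complex.norm_ofNat]
      rw [div_le_one (by positivity)]
      linarith [Real.pi_gt_three]
    cases m with
    | zero =>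
      refine ⟨μ ^ 2 * (16 * R ^ 2 + 1) + (μ ^ 2 * δ)⁻¹ + Real.pi, fun ε hε θ hθ x hx => ?_⟩
      obtain ⟨h1, h2, -⟩ := hmain ε hε θ hθ x hx
      have hθ0 := hθ.1
      have hθ1 : θ ≤ 1 := hθ.2.trans pi_div_four_le_one
      simp only [wickTuple_apply, ← map_sub, propDeriv]
      set w := regSq ε (wickCLM θ (x i - x j)) with hw
      have hwpos : 0 < ‖w‖ := lt_of_lt_of_le (by positivity) h1
      have hμw : ‖(μ : ℂ) ^ 2 * w‖ = μ ^ 2 * ‖w‖ := by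
        rw [norm_mul, norm_pow, Complex.norm_real, Real.norm_of_nonneg hμ.le]
      have hlog := norm_log_le (w := (μ : ℂ) ^ 2 * w) (norm_pos_iff.1 (by rw [hμw]; positivity))
      rw [hμw] at hlog
      rw [norm_mul]
      calc θ ^ (0 + 1) * (‖-(1 / (4 * (Real.pi : ℂ)))‖ * ‖Complex.log ((μ : ℂ) ^ 2 * w)‖)
          ≤ θ * (1 * (μ ^ 2 * ‖w‖ + (μ ^ 2 * ‖w‖)⁻¹ + Real.pi)) := by
            rw [zero_add, pow_one]
            gcongr
        _ = θ * (μ ^ 2 * ‖w‖) + θ * (μ ^ 2 * ‖w‖)⁻¹ + θ * Real.pi := by ring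
        _ ≤ μ ^ 2 * (16 * R ^ 2 + 1) + (μ ^ 2 * δ)⁻¹ + Real.pi := by
            refine add_le_add (add_le_add ?_ ?_) (mul_le_of_le_one_left Real.pi_pos.le hθ1)
            · exact (mul_le_of_le_one_left (by positivity) hθ1).trans (by gcongr)
            · rw [mul_inv_le_iff₀ (by positivity), inv_mul_eq_div, le_div_iff₀ (by positivity)]
              nlinarith [sq_nonneg μ]
    | succ m =>
      refine ⟨m.factorial * (8 * R / δ) ^ (m + 1), fun ε hε θ hθ x hx => ?_⟩
      obtain ⟨h1, -, h3⟩ := hmain ε hε θ hθ x hx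
      have hθ0 := hθ.1
      have hθ1 : θ ≤ 1 := hθ.2.trans pi_div_four_le_one
      simp only [wickTuple_apply, ← map_sub, propDeriv]
      set w := regSq ε (wickCLM θ (x i - x j)) with hw
      have hwpos : 0 < ‖w‖ := lt_of_lt_of_le (by positivity) h1
      have hR0 : 0 ≤ R := (norm_nonneg _).trans (hR x hx)
      have hq : θ * (‖4 * (wickCLM θ (x i - x j)).1‖ / ‖w‖) ≤ 8 * R / δ := by
        rw [mul_div_assoc', div_le_div_iff₀ hwpos hδ]
        calc θ * ‖4 * (wickCLM θ (x i - x j)).1‖ * δ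
            = ‖4 * (wickCLM θ (x i - x j)).1‖ * (θ * δ) := by ring
          _ ≤ 8 * R * ‖w‖ := mul_le_mul h3 h1 (by positivity) (by positivity)
      rw [norm_mul, norm_mul, norm_mul, norm_pow, norm_neg (1 : ℂ), norm_one, one_pow, one_mul,
        norm_div, norm_pow, norm_pow, ← div_pow, Complex.norm_natCast]
      calc θ ^ (m + 1 + 1) * (‖-(1 / (4 * (Real.pi : ℂ)))‖ *
            ((m.factorial : ℝ) * (‖4 * (wickCLM θ (x i - x j)).1‖ / ‖w‖) ^ (m + 1)))
          ≤ θ ^ (m + 1) * (1 *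
            ((m.factorial : ℝ) * (‖4 * (wickCLM θ (x i - x j)).1‖ / ‖w‖) ^ (m + 1))) := by
            gcongr ?_ * (?_ * _)
            exact pow_le_pow_of_le_one hθ0.le hθ1 (Nat.le_succ _)
        _ = m.factorial * (θ * (‖4 * (wickCLM θ (x i - x j)).1‖ / ‖w‖)) ^ (m + 1) := by
            rw [mul_pow]
            ring
        _ ≤ m.factorial * (8 * R / δ) ^ (m + 1) := by gcongr
  tendsto θ hθ x hx := by
    -- At a positive angle the imaginary part is positive even for ε = 0, so the limit is simply the
    -- value at ε = 0.
    have him : 0 < (regSq 0 (wickCLM θ (x i - x j))).im := by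
      rw [regSq_wickCLM_im, add_zero]
      have hne : x i - x j ≠ 0 := sub_ne_zero.2 (Function.Injective.ne hx hij)
      have hpos : 0 < (x i - x j).1 ^ 2 + (x i - x j).2 ^ 2 := by
        by_contra hle
        refine hne (Prod.ext ?_ ?_)
        · exact pow_eq_zero_iff two_ne_zero |>.1 (by
            nlinarith [sq_nonneg (x i - x j).1, sq_nonneg (x i - x j).2])
        · exact pow_eq_zero_iff two_ne_zero |>.1 (by
            nlinarith [sq_nonneg (x i - x j).1, sq_nonneg (x i - x j).2])
      exact mul_pos (hθ.1.trans_le (le_cos_mul_sin ⟨hθ.1.le, hθ.2⟩)) hpos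
    refine ⟨propDeriv μ m 0 (wickCLM θ (x i - x j)), ?_⟩
    simp only [wickTuple_apply, ← map_sub]
    have hreg : ContinuousAt (fun ε : ℝ => regSq ε (wickCLM θ (x i - x j))) 0 := by
      unfold regSq
      fun_prop
    have : ContinuousAt (fun ε : ℝ => propDeriv μ m ε (wickCLM θ (x i - x j))) 0 := by
      cases m with
      | zero =>
        exact continuousAt_const.mul ((continuousAt_const.mul hreg).clog (mul_mem_slitPlane hμ him))
      | succ m =>
        exact continuousAt_const.mul (continuousAt_const.mul (continuousAt_const.div
          (hreg.pow _) (pow_ne_zero _ (ne_zero_of_im_pos him))))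
    exact this.tendsto.mono_left nhdsWithin_le_nhds

/-! ### Jets of configurations -/

theorem Conf.contDiff (φ : Conf) : ContDiff ℝ ∞ φ.1 := φ.2

theorem hasDerivAt_snd_line {F : Type*} [NormedAddCommGroup F] [NormedSpace ℝ F] {f : Mink → F}
    {x : Mink} (hf : DifferentiableAt ℝ f x) :
    HasDerivAt (fun s => f (x.1, s)) (fderiv ℝ f x (0, 1)) x.2 := by
  have h : HasDerivAt (fun s : ℝ => ((x.1, s) : Mink)) (0, 1) x.2 :=
    (hasDerivAt_const _ _).prodMk (hasDerivAt_id _)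
  exact HasFDerivAt.comp_hasDerivAt (f := fun s : ℝ => ((x.1, s) : Mink)) x.2 hf.hasFDerivAt h

theorem dXi_eq_fderiv {f : Mink → ℝ} (hf : ContDiff ℝ ∞ f) :
    dXi f = fun x => fderiv ℝ f x (0, 1) :=
  funext fun x => (hasDerivAt_snd_line (hf.differentiable (by simp) x)).deriv

theorem contDiff_dXi {f : Mink → ℝ} (hf : ContDiff ℝ ∞ f) : ContDiff ℝ ∞ (dXi f) := by
  rw [dXi_eq_fderiv hf]
  exact (hf.fderiv_right (m := ∞) (by simp)).clm_apply contDiff_const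

/-- `∂/∂ξ` as a linear map on configurations. -/
def dXiLin : Conf →ₗ[ℝ] Conf where
  toFun φ := ⟨dXi φ.1, contDiff_dXi φ.contDiff⟩
  map_add' φ ψ := by
    ext x
    change dXi (fun x => φ.1 x + ψ.1 x) x = dXi φ.1 x + dXi ψ.1 x
    rw [dXi_eq_fderiv (φ.contDiff.add ψ.contDiff), dXi_eq_fderiv φ.contDiff,
      dXi_eq_fderiv ψ.contDiff]
    simp only
    rw [fderiv_fun_add (φ.contDiff.differentiable (by simp) x) (ψ.contDiff.differentiable (by simp) x)]
    rfl
  map_smul' c φ := by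
    ext x
    change dXi (fun x => c • φ.1 x) x = c • dXi φ.1 x
    rw [dXi_eq_fderiv (φ.contDiff.const_smul c), dXi_eq_fderiv φ.contDiff]
    simp only
    rw [fderiv_fun_const_smul (φ.contDiff.differentiable (by simp) x)]
    rfl

/-- The `m`-th `ξ`-derivative at the point `x`, as a linear functional of the configuration. -/
def jet (m : ℕ) (x : Mink) : Conf →ₗ[ℝ] ℝ where
  toFun φ := ((dXiLin ^ m) φ).1 x
  map_add' φ ψ := by
    rw [map_add]
    rfl
  map_smul' c φ := by
    rw [map_smul]
    rfl

theorem jet_apply (m : ℕ) (x : Mink) (φ : Conf) : jet m x φ = ((dXiLin ^ m) φ).1 x := rfl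

theorem jet_zero (x : Mink) (φ : Conf) : jet 0 x φ = φ.1 x := rfl

theorem jet_succ (m : ℕ) (φ : Conf) :
    (fun x => jet (m + 1) x φ) = dXi fun x => jet m x φ := by
  funext x
  rw [jet_apply, pow_succ', Module.End.mul_apply]
  rfl

theorem contDiff_jet (m : ℕ) (φ : Conf) : ContDiff ℝ ∞ fun x => jet m x φ :=
  ((dXiLin ^ m) φ).contDiff

theorem hasCompactSupport_jet (m : ℕ) {φ : Conf} (hφ : HasCompactSupport φ.1) :
    HasCompactSupport fun x => jet m x φ := by
  induction m with
  | zero => exact hφ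
  | succ m ih =>
    rw [jet_succ, dXi_eq_fderiv (contDiff_jet m φ)]
    exact (ih.fderiv ℝ).comp_left (g := fun L : Mink →L[ℝ] ℝ => L (0, 1)) rfl

theorem dXi_comp_sub (f : Mink → ℝ) (v x : Mink) : dXi (fun y => f (y - v)) x = dXi f (x - v) :=
  deriv_comp_sub_const (fun s => f (x.1 - v.1, s)) v.2 x.2

/-- Translation covariance turns the smearing point into a shift of the argument, so that the
integrals over it become convolutions. -/
theorem jet_deltaApprox (m k : ℕ) (x v : Mink) :
    jet m x (deltaApprox k v) = jet m (x - v) (deltaApprox k 0) := by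
  induction m generalizing x with
  | zero =>
    rw [jet_zero, jet_zero]
    simp [deltaApprox]
  | succ m ih =>
    have h1 := congrFun (jet_succ m (deltaApprox k v)) x
    have h2 := congrFun (jet_succ m (deltaApprox k 0)) (x - v)
    rw [h1, h2]
    simp_rw [ih]
    exact dXi_comp_sub _ v x

theorem deltaApprox_apply (k : ℕ) (u y : Mink) :
    (deltaApprox k u).1 y = (bump k).normed volume (y - u) := rfl

theorem hasCompactSupport_deltaApprox_zero (k : ℕ) : HasCompactSupport (deltaApprox k 0).1 := by
  have : (deltaApprox k 0).1 = (bump k).normed volume := by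
    funext y
    rw [deltaApprox_apply, sub_zero]
  rw [this]
  exact (bump k).hasCompactSupport_normed

theorem hasCompactSupport_comp_sub {F : Type*} [Zero F] {f : Mink → F} (hf : HasCompactSupport f)
    (y : Mink) : HasCompactSupport fun v => f (y - v) :=
  hf.comp_homeomorph (Homeomorph.subLeft y)

/-! ### Contractions of point functionals -/

/-- A sequence of continuous functions each of which is the `ξ`-derivative of the preceding one. -/
structure IsXiTower (H : ℕ → Mink → ℂ) : Prop where
  continuous : ∀ m, Continuous (H m)
  hasDerivAt : ∀ m x, HasDerivAt (fun s => H m (x.1, s)) (H (m + 1) x) x.2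

theorem isXiTower_propDeriv {μ : ℝ} (hμ : 0 < μ) {ε : ℝ} (hε : 0 < ε) :
    IsXiTower fun m x => propDeriv μ m ε (complexify x) where
  continuous m := continuous_propDeriv hμ m hε
  hasDerivAt m x := hasDerivAt_propDeriv hμ m hε x

theorem IsXiTower.integral_mul_jet_succ {H : ℕ → Mink → ℂ} (hH : IsXiTower H) (r m : ℕ) {φ : Conf}
    (hφ : HasCompactSupport φ.1) (u y : Mink) :
    ∫ v, H r (u - v) * (jet (m + 1) (y - v) φ : ℂ) =
      -∫ v, H (r + 1) (u - v) * (jet m (y - v) φ : ℂ) := by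
  have hHc : ∀ r, Continuous fun v => H r (u - v) := fun r =>
    (hH.continuous r).comp (continuous_const.sub continuous_id)
  have hjc : ∀ m, Continuous fun v => (jet m (y - v) φ : ℂ) := fun m =>
    Complex.continuous_ofReal.comp
      ((contDiff_jet m φ).continuous.comp (continuous_const.sub continuous_id))
  have hjs : ∀ m, HasCompactSupport fun v => (jet m (y - v) φ : ℂ) := fun m =>
    (hasCompactSupport_comp_sub (hasCompactSupport_jet m hφ) y).comp_left (g := Complex.ofReal)
      Complex.ofReal_zero
  have hI : ∀ r m, Integrable fun v => H r (u - v) * (jet m (y - v) φ : ℂ) := fun r m =>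
    ((hHc r).mul (hjc m)).integrable_of_hasCompactSupport (hjs m).mul_left
  have hline : ∀ (G G' : Mink → ℂ) (w : Mink), (∀ x : Mink, HasDerivAt (fun s => G (x.1, s)) (G' x) x.2) →
      ∀ v, HasLineDerivAt ℝ (fun v => G (w - v)) (-G' (w - v)) v ((0, 1) : Mink) := by
    intro G G' w hG v
    have h := hG (w - v)
    have h2 : HasDerivAt (fun t : ℝ => (w - v).2 - t) (-1) 0 := by
      simpa using (hasDerivAt_id (0 : ℝ)).const_sub (w - v).2
    have h3 := HasDerivAt.scomp (h := fun t : ℝ => (w - v).2 - t)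
      (g₁ := fun s => G ((w - v).1, s)) (g₁' := G' (w - v)) 0 (by simpa using h) h2
    rw [HasLineDerivAt]
    convert h3 using 1
    · funext t
      simp only [Function.comp_apply]
      congr 1
      ext <;> simp [sub_sub]
    · simp
  -- Both factors depend on -v, so each line derivative carries its own minus sign. These cancel
  -- between the two sides, and the sign of integration by parts remains.
  have h := integral_bilinear_hasLineDerivAt_right_eq_neg_left_of_integrable
    (μ := (volume : Measure Mink)) (B := ContinuousLinearMap.mul ℝ ℂ) (v := ((0, 1) : Mink))
    (f := fun v => H r (u - v)) (f' := fun v => -H (r + 1) (u - v))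
    (g := fun v => (jet m (y - v) φ : ℂ)) (g' := fun v => -(jet (m + 1) (y - v) φ : ℂ))
    (by simpa using (hI (r + 1) m).neg) (by simpa using (hI r (m + 1)).neg) (hI r m)
    (fun v _ => hline (H r) (H (r + 1)) u (hH.hasDerivAt r) v)
    (fun v _ => hline (fun x => (jet m x φ : ℂ)) (fun x => (jet (m + 1) x φ : ℂ)) y
      (fun x => by
        have h1 := hasDerivAt_snd_line ((contDiff_jet m φ).differentiable (by simp) x)
        have h2 := congrFun (jet_succ m φ) x
        rw [dXi_eq_fderiv (contDiff_jet m φ)] at h2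
        simp only at h2
        rw [h2]
        exact h1.ofReal_comp) v)
  simp only [ContinuousLinearMap.mul_apply', mul_neg, neg_mul, integral_neg, neg_neg] at h
  rw [← h, neg_neg]

theorem IsXiTower.integral_mul_jet {H : ℕ → Mink → ℂ} (hH : IsXiTower H) (m : ℕ) {φ : Conf}
    (hφ : HasCompactSupport φ.1) (u y : Mink) :
    ∫ v, H 0 (u - v) * (jet m (y - v) φ : ℂ) =
      (-1) ^ m * ∫ v, H m (u - v) * (φ.1 (y - v) : ℂ) := by
  -- The index `r` has to vary in the induction, since each integration by parts raises the order of
  -- the kernel.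
  have : ∀ r, ∫ v, H r (u - v) * (jet m (y - v) φ : ℂ) =
      (-1) ^ m * ∫ v, H (r + m) (u - v) * (φ.1 (y - v) : ℂ) := by
    induction m with
    | zero =>
      intro r
      simp [jet_zero]
    | succ m ih =>
      intro r
      rw [hH.integral_mul_jet_succ r m hφ, ih, pow_succ]
      rw [show r + 1 + m = r + (m + 1) by ring]
      ring
  simpa using this 0

open scoped Convolution in
theorem integral_mul_deltaApprox {G : Mink → ℂ} (k : ℕ) (u y : Mink) :
    ∫ v, G (u - v) * ((deltaApprox k 0).1 (y - v) : ℂ) =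
      ((bump k).normed volume ⋆[ContinuousLinearMap.lsmul ℝ ℝ, volume] G) (u - y) := by
  rw [convolution_def]
  have h1 := integral_sub_left_eq_self (μ := (volume : Measure Mink))
    (fun t => G (u - y + t) * ((deltaApprox k 0).1 t : ℂ)) y
  have h2 := integral_neg_eq_self (μ := (volume : Measure Mink))
    (fun t => G (u - y + t) * ((deltaApprox k 0).1 t : ℂ))
  have h3 : ∀ v, u - y + (y - v) = u - v := fun v => by abel
  simp only [h3] at h1
  rw [h1, ← h2]
  refine integral_congr_ae (Eventually.of_forall fun t => ?_)
  simp only [deltaApprox_apply, sub_zero, ContDiffBump.normed_neg, ContinuousLinearMap.lsmul_apply,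
    Complex.real_smul, ← sub_eq_add_neg]
  ring

theorem tendsto_bump_rOut : Tendsto (fun k => (bump k).rOut) atTop (𝓝 0) := by
  simpa [bump] using tendsto_one_div_add_atTop_nhds_zero_nat (𝕜 := ℝ)

/-- The functionals `D` and `E`, applied to the two arguments of the kernel `H (u - v)`, give the
number `c`, the functionals being smeared with approximate delta functions. -/
structure HasContraction (H : Mink → ℂ) (D E : Conf → ℂ) (c : ℂ) : Prop where
  integrable : ∀ k u, Integrable fun v => D (deltaApprox k u) * H (u - v) * E (deltaApprox k v)
  integrable_integral : ∀ k, Integrable fun u =>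
    ∫ v, D (deltaApprox k u) * H (u - v) * E (deltaApprox k v)
  tendsto : Tendsto (fun k => ∫ u, ∫ v, D (deltaApprox k u) * H (u - v) * E (deltaApprox k v))
    atTop (𝓝 c)

-- The m derivatives fall on the second argument of H(u - v), hence the sign. The double integral is
-- `H m` convolved with the bump function twice at the same scale k. The joint limit in k and the
-- evaluation point for the inner convolution (`h1`) is what allows both bumps to shrink together.
open scoped Convolution in
theorem IsXiTower.hasContraction {H : ℕ → Mink → ℂ} (hH : IsXiTower H) (m : ℕ) (x y : Mink) :
    HasContraction (H 0) (fun h => (h.1 x : ℂ)) (fun h => (jet m y h : ℂ))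
      ((-1) ^ m * H m (x - y)) := by
  have hinner : ∀ k u, ∫ v, ((deltaApprox k u).1 x : ℂ) * H 0 (u - v) * (jet m y (deltaApprox k v) : ℂ) =
      (-1) ^ m * ((deltaApprox k 0).1 (x - u) *
        ((bump k).normed volume ⋆[ContinuousLinearMap.lsmul ℝ ℝ, volume] H m) (u - y)) := by
    intro k u
    simp_rw [mul_assoc, jet_deltaApprox m k y]
    rw [integral_const_mul, hH.integral_mul_jet m (hasCompactSupport_deltaApprox_zero k),
      integral_mul_deltaApprox, deltaApprox_apply, deltaApprox_apply, sub_zero]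
    ring
  have hconv : ∀ k, Continuous
      ((bump k).normed volume ⋆[ContinuousLinearMap.lsmul ℝ ℝ, volume] H m) := fun k =>
    (bump k).hasCompactSupport_normed.continuous_convolution_left _
      ((bump k).contDiff_normed (n := 0)).continuous (hH.continuous m).locallyIntegrable
  have hδc : ∀ k, Continuous (deltaApprox k 0).1 := fun k => (deltaApprox k 0).contDiff.continuous
  constructor
  · intro k u
    simp_rw [jet_deltaApprox m k y]
    refine Continuous.integrable_of_hasCompactSupport ?_ (HasCompactSupport.mul_left ?_)
    · exact (continuous_const.mul ((hH.continuous 0).comp (continuous_const.sub continuous_id))).mul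
        (Complex.continuous_ofReal.comp
          ((contDiff_jet m _).continuous.comp (continuous_const.sub continuous_id)))
    · exact (hasCompactSupport_comp_sub (hasCompactSupport_jet m
        (hasCompactSupport_deltaApprox_zero k)) y).comp_left (g := Complex.ofReal) Complex.ofReal_zero
  · intro k
    simp_rw [hinner]
    refine Continuous.integrable_of_hasCompactSupport ?_
      (HasCompactSupport.mul_left (HasCompactSupport.mul_right ?_))
    · exact continuous_const.mul ((Complex.continuous_ofReal.comp
        ((hδc k).comp (continuous_const.sub continuous_id))).mul
          ((hconv k).comp (continuous_id.sub continuous_const)))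
    · exact (hasCompactSupport_comp_sub (hasCompactSupport_deltaApprox_zero k) x).comp_left
        (g := Complex.ofReal) Complex.ofReal_zero
  · simp_rw [hinner, integral_const_mul]
    refine Tendsto.const_mul _ ?_
    have h1 : Tendsto (fun p : ℕ × Mink =>
        ((bump p.1).normed volume ⋆[ContinuousLinearMap.lsmul ℝ ℝ, volume] H m) (p.2 - y))
        (atTop ×ˢ 𝓝 x) (𝓝 (H m (x - y))) := by
      refine ContDiffBump.convolution_tendsto_right (φ := fun p : ℕ × Mink => bump p.1)
        (g := fun _ => H m) (k := fun p => p.2 - y) (x₀ := x - y)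
        (tendsto_bump_rOut.comp tendsto_fst)
        (Eventually.of_forall fun _ => (hH.continuous m).aestronglyMeasurable) ?_
        (tendsto_snd.sub_const y)
      exact ((hH.continuous m).tendsto (x - y)).comp tendsto_snd
    have h2 := ContDiffBump.convolution_tendsto_right (μ := (volume : Measure Mink))
      (φ := bump) (k := fun _ => x) (x₀ := x) tendsto_bump_rOut
      (g := fun k u => ((bump k).normed volume ⋆[ContinuousLinearMap.lsmul ℝ ℝ, volume] H m) (u - y))
      (Eventually.of_forall fun k =>
        ((hconv k).comp (continuous_id.sub continuous_const)).aestronglyMeasurable) h1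
      tendsto_const_nhds
    refine h2.congr fun k => ?_
    rw [convolution_def]
    have h3 := integral_sub_left_eq_self (μ := (volume : Measure Mink)) (fun u =>
      ((deltaApprox k 0).1 (x - u) : ℂ) *
        ((bump k).normed volume ⋆[ContinuousLinearMap.lsmul ℝ ℝ, volume] H m) (u - y)) x
    rw [← h3]
    refine integral_congr_ae (Eventually.of_forall fun t => ?_)
    simp [deltaApprox_apply]

theorem HasContraction.const_mul {H : Mink → ℂ} {D E : Conf → ℂ} {c : ℂ} (h : HasContraction H D E c)
    (w z : ℂ) : HasContraction H (fun f => w * D f) (fun f => z * E f) (w * z * c) := by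
  have hr : ∀ k u v, w * D (deltaApprox k u) * H (u - v) * (z * E (deltaApprox k v)) =
      w * z * (D (deltaApprox k u) * H (u - v) * E (deltaApprox k v)) := fun k u v => by ring
  constructor
  · intro k u
    simp_rw [hr]
    exact (h.integrable k u).const_mul _
  · intro k
    simp_rw [hr, integral_const_mul]
    exact (h.integrable_integral k).const_mul _
  · simp_rw [hr, integral_const_mul]
    exact h.tendsto.const_mul _

theorem HasContraction.sum {ι : Type*} (s : Finset ι) {H : Mink → ℂ} {D : ι → Conf → ℂ}
    {E : Conf → ℂ} {c : ι → ℂ} (h : ∀ i ∈ s, HasContraction H (D i) E (c i)) :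
    HasContraction H (fun f => ∑ i ∈ s, D i f) E (∑ i ∈ s, c i) := by
  have hI : ∀ k u, ∫ v, ∑ i ∈ s, D i (deltaApprox k u) * H (u - v) * E (deltaApprox k v) =
      ∑ i ∈ s, ∫ v, D i (deltaApprox k u) * H (u - v) * E (deltaApprox k v) := fun k u =>
    integral_finsetSum _ fun i hi => (h i hi).integrable k u
  constructor
  · intro k u
    simp_rw [Finset.sum_mul]
    exact integrable_finsetSum _ fun i hi => (h i hi).integrable k u
  · intro k
    simp_rw [Finset.sum_mul, hI]
    exact integrable_finsetSum _ fun i hi => (h i hi).integrable_integral k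
  · simp_rw [Finset.sum_mul, hI]
    have : ∀ k, ∫ u, ∑ i ∈ s, ∫ v, D i (deltaApprox k u) * H (u - v) * E (deltaApprox k v) =
        ∑ i ∈ s, ∫ u, ∫ v, D i (deltaApprox k u) * H (u - v) * E (deltaApprox k v) := fun k =>
      integral_finsetSum _ fun i hi => (h i hi).integrable_integral k
    simp_rw [this]
    exact tendsto_finsetSum _ fun i hi => (h i hi).tendsto

/-- On products of one-argument functionals the smeared integrand is a product over the n
propagators, so Fubini reduces everything to single contractions. Each of these converges, and
therefore the `limUnder` in `pairing` is a genuine limit. -/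
theorem pairing_eq_sum {ι κ : Type*} [Fintype ι] [Fintype κ] {n : ℕ} {H : Mink → ℂ}
    {A B : (Fin n → Conf) → ℂ} {a : ι → ℂ} {D : ι → Fin n → Conf → ℂ} {b : κ → ℂ}
    {E : κ → Fin n → Conf → ℂ} {c : ι → κ → Fin n → ℂ}
    (hA : ∀ h, A h = ∑ s, a s * ∏ i, D s i (h i)) (hB : ∀ h, B h = ∑ t, b t * ∏ i, E t i (h i))
    (hc : ∀ s t i, HasContraction H (D s i) (E t i) (c s t i)) :
    pairing n H A B = ∑ s, ∑ t, a s * b t * ∏ i, c s t i := by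
  let I : ι → κ → Fin n → ℕ → Mink → Mink → ℂ := fun s t i k u v =>
    D s i (deltaApprox k u) * H (u - v) * E t i (deltaApprox k v)
  have hexp : ∀ (k : ℕ) (u v : Fin n → Mink), A (fun i => deltaApprox k (u i)) *
      (∏ i, H (u i - v i)) * B (fun i => deltaApprox k (v i)) =
      ∑ s, ∑ t, a s * b t * ∏ i, I s t i k (u i) (v i) := by
    intro k u v
    rw [hA, hB, Finset.sum_mul, Finset.sum_mul_sum]
    refine Finset.sum_congr rfl fun s _ => Finset.sum_congr rfl fun t _ => ?_
    simp only [I, Finset.prod_mul_distrib]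
    ring
  have hint : ∀ (k : ℕ) (u : Fin n → Mink), ∫ v : Fin n → Mink,
      ∑ s, ∑ t, a s * b t * ∏ i, I s t i k (u i) (v i) =
      ∑ s, ∑ t, a s * b t * ∏ i, ∫ v, I s t i k (u i) v := by
    intro k u
    have hi : ∀ s t, Integrable fun v : Fin n → Mink => a s * b t * ∏ i, I s t i k (u i) (v i) :=
      fun s t => (Integrable.fintype_prod fun i => (hc s t i).integrable k (u i)).const_mul _
    rw [integral_finsetSum _ fun s _ => integrable_finsetSum _ fun t _ => hi s t]
    refine Finset.sum_congr rfl fun s _ => ?_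
    rw [integral_finsetSum _ fun t _ => hi s t]
    refine Finset.sum_congr rfl fun t _ => ?_
    rw [integral_const_mul, integral_fintype_prod_volume_eq_prod]
  have hint2 : ∀ k : ℕ, ∫ u : Fin n → Mink, ∑ s, ∑ t, a s * b t * ∏ i, ∫ v, I s t i k (u i) v =
      ∑ s, ∑ t, a s * b t * ∏ i, ∫ u, ∫ v, I s t i k u v := by
    intro k
    have hi : ∀ s t, Integrable fun u : Fin n → Mink =>
        a s * b t * ∏ i, ∫ v, I s t i k (u i) v := fun s t =>
      (Integrable.fintype_prod (f := fun i u => ∫ v, I s t i k u v)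
        fun i => (hc s t i).integrable_integral k).const_mul _
    rw [integral_finsetSum _ fun s _ => integrable_finsetSum _ fun t _ => hi s t]
    refine Finset.sum_congr rfl fun s _ => ?_
    rw [integral_finsetSum _ fun t _ => hi s t]
    refine Finset.sum_congr rfl fun t _ => ?_
    rw [integral_const_mul, integral_fintype_prod_volume_eq_prod fun i u => ∫ v, I s t i k u v]
  rw [pairing]
  simp_rw [hexp, hint, hint2]
  exact (tendsto_finsetSum _ fun s _ => tendsto_finsetSum _ fun t _ =>
    (tendsto_finsetProd _ fun i _ => (hc s t i).tendsto).const_mul _).limUnder_eq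

/-! ### Exponential observables -/

theorem hasContraction_feynman {μ : ℝ} (hμ : 0 < μ) {ε : ℝ} (hε : 0 < ε) (m : ℕ) (x y : Mink) :
    HasContraction (feynman μ ε) (fun h => (h.1 x : ℂ)) (fun h => (jet m y h : ℂ))
      ((-1) ^ m * propDeriv μ m ε (complexify (x - y))) := by
  rw [funext (feynman_eq_propDeriv μ ε)]
  exact (isXiTower_propDeriv hμ hε).hasContraction m x y

/-- The exponential of a linear functional ℓ is an eigenvector of the directional derivative along
h, with eigenvalue ℓ(h). -/
theorem funcDeriv_sum_exp {κ : Type*} [Fintype κ] (C : κ → ℂ) (ℓ : κ → Conf →ₗ[ℝ] ℂ) (n : ℕ)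
    (h : Fin n → Conf) :
    funcDeriv n h (fun φ => ∑ s, C s * Complex.exp (ℓ s φ)) =
      fun φ => ∑ s, (C s * Complex.exp (ℓ s φ)) * ∏ i, ℓ s (h i) := by
  induction n with
  | zero => simp [funcDeriv]
  | succ n ih =>
    rw [funcDeriv, ih]
    funext φ
    have hd : ∀ s, HasDerivAt (fun t : ℝ => (C s * Complex.exp (ℓ s (φ + t • h 0))) *
        ∏ i : Fin n, ℓ s (h i.succ))
        ((C s * Complex.exp (ℓ s φ)) * ∏ i, ℓ s (h i)) 0 := by
      intro s
      have h1 : HasDerivAt (fun t : ℝ => ℓ s (φ + t • h 0)) (ℓ s (h 0)) 0 := by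
        have h2 := ((hasDerivAt_id (0 : ℝ)).ofReal_comp.mul_const (ℓ s (h 0))).const_add (ℓ s φ)
        simpa using h2
      refine ((h1.cexp.const_mul (C s)).mul_const _).congr_deriv ?_
      rw [zero_smul, add_zero, Fin.prod_univ_succ]
      ring
    exact (HasDerivAt.fun_sum fun s _ => hd s).deriv

/-- The sign of a charge. -/
def chargeSign (s : Bool) : ℂ := if s then 1 else -1

/-- The exponent `± i a φ(x)` of the vertex operators. -/
def vertexExp (a : ℝ) (s : Bool) (x : Mink) : Conf →ₗ[ℝ] ℂ :=
  (Complex.I * a * chargeSign s) • (Complex.ofRealCLM.toLinearMap ∘ₗ jet 0 x)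

theorem vertexExp_apply (a : ℝ) (s : Bool) (x : Mink) (φ : Conf) :
    vertexExp a s x φ = Complex.I * a * chargeSign s * (φ.1 x : ℂ) := rfl

theorem lInt_eq_sum_exp (a : ℝ) (x : Mink) :
    lInt a x = fun φ => ∑ s : Bool, (1 / 2 : ℂ) * Complex.exp (vertexExp a s x φ) := by
  funext φ
  rw [lInt, Complex.ofReal_cos, Complex.cos]
  simp only [vertexExp_apply, chargeSign, Fintype.sum_bool, if_true, Bool.false_eq_true, if_false]
  push_cast
  rw [show ((a : ℂ) * (φ.1 x : ℂ)) * Complex.I = Complex.I * a * 1 * (φ.1 x : ℂ) by ring,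
    show -((a : ℂ) * (φ.1 x : ℂ)) * Complex.I = Complex.I * a * (-1) * (φ.1 x : ℂ) by ring]
  ring

theorem funcDeriv_lInt (a : ℝ) (x : Mink) (n : ℕ) (h : Fin n → Conf) :
    funcDeriv n h (lInt a x) = fun φ => ∑ s : Bool,
      ((1 / 2 : ℂ) * ∏ i, vertexExp a s x (h i)) * Complex.exp (vertexExp a s x φ) := by
  rw [lInt_eq_sum_exp, funcDeriv_sum_exp]
  funext φ
  refine Finset.sum_congr rfl fun s _ => ?_
  ring

/-! ### Star products -/

theorem funcDeriv_zero (n : ℕ) (h : Fin n → Conf) : funcDeriv n h (0 : Obs) = 0 := by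
  induction n with
  | zero => rfl
  | succ n ih =>
    rw [funcDeriv, ih]
    funext φ
    simp [dirDeriv]

theorem pairing_zero_right (n : ℕ) (H : Mink → ℂ) (A : (Fin n → Conf) → ℂ) :
    pairing n H A (fun _ => 0) = 0 := by
  simp only [pairing, mul_zero, integral_zero]
  exact tendsto_const_nhds.limUnder_eq

theorem coeff_star_C (H : Mink → ℂ) (F : PowerSeries Obs) (G : Obs) (p : ℕ) (φ : Conf) :
    PowerSeries.coeff p (star H F (PowerSeries.C G)) φ =
      ∑ n ∈ Finset.range (p + 1), ((n.factorial : ℂ))⁻¹ * pairing n H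
        (fun h => funcDeriv n h (PowerSeries.coeff (p - n) F) φ) (fun h => funcDeriv n h G φ) := by
  rw [star, PowerSeries.coeff_mk]
  refine Finset.sum_congr rfl fun n _ => ?_
  rw [Finset.sum_eq_single (p - n, 0)]
  · simp
  · rintro ⟨b, c⟩ hbc hne
    have hc : c ≠ 0 := by
      rintro rfl
      rw [Finset.HasAntidiagonal.mem_antidiagonal, add_zero] at hbc
      exact hne (by rw [← hbc])
    simp only [PowerSeries.coeff_C, if_neg hc, funcDeriv_zero]
    have := pairing_zero_right n H fun h => funcDeriv n h (PowerSeries.coeff b F) φ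
    simp [this]
  · intro hn
    simp at hn

/-- The sum of all propagators joining the vertex operators with charges `σ` at the points `x`. -/
def vertexEnergy (a : ℝ) (H : Mink → ℂ) : (l : ℕ) → (Fin l → Bool) → (Fin l → Mink) → ℂ
  | 0, _, _ => 0
  | l + 1, σ, x => vertexEnergy a H l (fun i => σ i.castSucc) (fun i => x i.castSucc) +
      ∑ i : Fin l, Complex.I * a * chargeSign (σ i.castSucc) *
        (Complex.I * a * chargeSign (σ (Fin.last l))) * H (x i.castSucc - x (Fin.last l))

/-- The coefficient of ħ^p in exp(ħ(x + y)) = exp(ħx) exp(ħy), arranged as it occurs in the star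
product. -/
theorem add_pow_div_factorial (x y : ℂ) (p : ℕ) :
    (x + y) ^ p / (p.factorial : ℂ) = ∑ n ∈ Finset.range (p + 1),
      ((n.factorial : ℂ))⁻¹ * (x ^ (p - n) / ((p - n).factorial : ℂ)) * y ^ n := by
  rw [add_comm, add_pow, Finset.sum_div]
  refine Finset.sum_congr rfl fun n hn => ?_
  have hnp : n ≤ p := Nat.lt_succ_iff.1 (Finset.mem_range.1 hn)
  have h1 : (n.factorial : ℂ) ≠ 0 := by exact_mod_cast n.factorial_ne_zero
  have h2 : ((p - n).factorial : ℂ) ≠ 0 := by exact_mod_cast (p - n).factorial_ne_zero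
  have h3 : (p.factorial : ℂ) ≠ 0 := by exact_mod_cast p.factorial_ne_zero
  rw [Nat.cast_choose ℂ hnp]
  field_simp

theorem pairing_sum_exp {H : Mink → ℂ} {κ κ' : Type*} [Fintype κ] [Fintype κ'] (C : κ → ℂ)
    (ℓ : κ → Conf →ₗ[ℝ] ℂ) (b : κ' → ℂ) (n : ℕ) (E : κ' → Fin n → Conf → ℂ) (φ : Conf) (B : (Fin n → Conf) → ℂ)
    (hB : ∀ h, B h = ∑ t, b t * ∏ i, E t i (h i)) (c : κ → κ' → Fin n → ℂ)
    (hc : ∀ s t i, HasContraction H (ℓ s) (E t i) (c s t i)) :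
    pairing n H (fun h => funcDeriv n h (fun φ => ∑ s, C s * Complex.exp (ℓ s φ)) φ) B =
      ∑ s, ∑ t, C s * Complex.exp (ℓ s φ) * b t * ∏ i, c s t i := by
  refine pairing_eq_sum (a := fun s => C s * Complex.exp (ℓ s φ)) (D := fun s _ => ℓ s) ?_ hB
    fun s t i => hc s t i
  intro h
  rw [funcDeriv_sum_exp]

theorem hasContraction_sum_vertexExp {H : Mink → ℂ} (a : ℝ) {l : ℕ} (σ : Fin l → Bool)
    (x : Fin l → Mink) {E : Conf → ℂ} {c : Fin l → ℂ}
    (h : ∀ i, HasContraction H (fun f => (f.1 (x i) : ℂ)) E (c i)) :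
    HasContraction H (∑ i, vertexExp a (σ i) (x i) : Conf →ₗ[ℝ] ℂ) E
      (∑ i, Complex.I * a * chargeSign (σ i) * c i) := by
  have h1 := HasContraction.sum Finset.univ fun i _ =>
    (h i).const_mul (Complex.I * a * chargeSign (σ i)) 1
  simp only [one_mul, mul_one] at h1
  convert h1 using 1
  funext f
  simp [LinearMap.sum_apply, vertexExp_apply]

theorem pairing_vertex {H : Mink → ℂ}
    (hH : ∀ x y, HasContraction H (fun h => (h.1 x : ℂ)) (fun h => (h.1 y : ℂ)) (H (x - y)))
    (a : ℝ) {l : ℕ} (C : (Fin l → Bool) → ℂ) (x : Fin l → Mink) (d : Bool → ℂ) (y : Mink) (n : ℕ)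
    (φ : Conf) :
    pairing n H (fun h => funcDeriv n h (fun φ => ∑ σ, C σ *
        Complex.exp ((∑ i, vertexExp a (σ i) (x i) : Conf →ₗ[ℝ] ℂ) φ)) φ)
      (fun h => funcDeriv n h (fun φ => ∑ t, d t * Complex.exp (vertexExp a t y φ)) φ) =
    ∑ σ, ∑ t, C σ * Complex.exp ((∑ i, vertexExp a (σ i) (x i) : Conf →ₗ[ℝ] ℂ) φ) *
      (d t * Complex.exp (vertexExp a t y φ)) *
      (∑ i : Fin l, Complex.I * a * chargeSign (σ i) *
            (Complex.I * a * chargeSign t) * H (x i - y)) ^ n := by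
  have hp := pairing_sum_exp (H := H) C (fun σ => ∑ i, vertexExp a (σ i) (x i))
    (fun t => d t * Complex.exp (vertexExp a t y φ)) n (fun t _ => vertexExp a t y) φ
    (fun h => funcDeriv n h (fun φ => ∑ t, d t * Complex.exp (vertexExp a t y φ)) φ)
    (fun h => by rw [funcDeriv_sum_exp])
    (fun σ t _ => ∑ i : Fin l, Complex.I * a * chargeSign (σ i) *
            ((Complex.I * a * chargeSign t) * H (x i - y))) ?_
  · rw [hp]
    simp only [Finset.prod_const, Finset.card_univ, Fintype.card_fin, mul_assoc]
  · intro σ t _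
    refine hasContraction_sum_vertexExp a σ x fun i => ?_
    have h := (hH (x i) y).const_mul 1 (Complex.I * a * chargeSign t)
    simp only [one_mul] at h
    exact h

/-- Multiplying by one more vertex operator contributes the exponential of ħ times its contractions
with the earlier ones, and the exponents add up to `vertexEnergy`. The coefficients `c` are
arbitrary because functional derivatives of cos(aφ) change only these coefficients; one formula thus
serves both sides of the expansion. -/
theorem coeff_timeOrdered {H : Mink → ℂ}
    (hH : ∀ x y, HasContraction H (fun h => (h.1 x : ℂ)) (fun h => (h.1 y : ℂ)) (H (x - y)))
    (a : ℝ) (l : ℕ) (c : Fin l → Bool → ℂ) (x : Fin l → Mink) (q : ℕ) :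
    PowerSeries.coeff q (timeOrdered H l fun i =>
        PowerSeries.C fun φ => ∑ s, c i s * Complex.exp (vertexExp a s (x i) φ)) =
      fun φ => ∑ σ : Fin l → Bool, (∏ i, c i (σ i)) *
        (vertexEnergy a H l σ x ^ q / (q.factorial : ℂ)) *
          Complex.exp ((∑ i, vertexExp a (σ i) (x i) : Conf →ₗ[ℝ] ℂ) φ) := by
  induction l generalizing q with
  | zero =>
    funext φ
    rcases q with _ | q
    · simp [timeOrdered, vertexEnergy]
    · simp [timeOrdered, vertexEnergy, PowerSeries.coeff_one]
  | succ l ih =>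
    funext φ
    rw [timeOrdered, coeff_star_C]
    have hstep : ∀ n ∈ Finset.range (q + 1), ((n.factorial : ℂ))⁻¹ * pairing n H
        (fun h => funcDeriv n h (PowerSeries.coeff (q - n) (timeOrdered H l fun i : Fin l =>
          PowerSeries.C fun φ => ∑ s, c i.castSucc s *
            Complex.exp (vertexExp a s (x i.castSucc) φ))) φ)
        (fun h => funcDeriv n h (fun φ => ∑ s, c (Fin.last l) s *
          Complex.exp (vertexExp a s (x (Fin.last l)) φ)) φ) =
        ∑ σ : Fin l → Bool, ∑ t : Bool, ((∏ i, c i.castSucc (σ i)) * c (Fin.last l) t *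
          (Complex.exp ((∑ i, vertexExp a (σ i) (x i.castSucc) : Conf →ₗ[ℝ] ℂ) φ) *
            Complex.exp (vertexExp a t (x (Fin.last l)) φ))) *
          (((n.factorial : ℂ))⁻¹ * (vertexEnergy a H l σ (fun i => x i.castSucc) ^ (q - n) /
            ((q - n).factorial : ℂ)) *
          (∑ i : Fin l, Complex.I * a * chargeSign (σ i) *
            (Complex.I * a * chargeSign t) * H (x i.castSucc - x (Fin.last l))) ^ n) := by
      intro n _
      rw [ih (fun i => c i.castSucc) (fun i => x i.castSucc) (q - n)]
      rw [pairing_vertex hH, Finset.mul_sum]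
      refine Finset.sum_congr rfl fun σ _ => ?_
      rw [Finset.mul_sum]
      refine Finset.sum_congr rfl fun t _ => ?_
      ring
    rw [Finset.sum_congr rfl hstep, Finset.sum_comm]
    rw [← (Fin.snocEquiv fun _ : Fin (l + 1) => Bool).sum_comp, Fintype.sum_prod_type_right]
    refine Finset.sum_congr rfl fun σ _ => ?_
    rw [Finset.sum_comm]
    refine Finset.sum_congr rfl fun t _ => ?_
    rw [← Finset.mul_sum, ← add_pow_div_factorial]
    simp only [Fin.snocEquiv, Equiv.coe_fn_mk, vertexEnergy, Fin.snoc_castSucc, Fin.snoc_last,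
      Fin.prod_univ_castSucc, Fin.sum_univ_castSucc, LinearMap.add_apply, Complex.exp_add]
    ring

/-! ### Polynomials in jets -/

/-- Fields which are polynomials of degree at most `d` in the `ξ`-derivatives of the configuration. -/
inductive IsJetPoly : ℕ → (Conf → Mink → ℝ) → Prop
  | const (d : ℕ) (c : ℝ) : IsJetPoly d fun _ _ => c
  | jet {d : ℕ} (hd : 1 ≤ d) (m : ℕ) : IsJetPoly d fun φ x => SineGordon.jet m x φ
  | add {d : ℕ} {F G : Conf → Mink → ℝ} (hF : IsJetPoly d F) (hG : IsJetPoly d G) :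
      IsJetPoly d fun φ x => F φ x + G φ x
  | mul {d e r : ℕ} {F G : Conf → Mink → ℝ} (hF : IsJetPoly d F) (hG : IsJetPoly e G)
      (hr : d + e ≤ r) : IsJetPoly r fun φ x => F φ x * G φ x

namespace IsJetPoly

theorem mono {d e : ℕ} {F : Conf → Mink → ℝ} (hF : IsJetPoly d F) (h : d ≤ e) : IsJetPoly e F := by
  induction hF generalizing e with
  | const d c => exact const e c
  | jet hd m => exact jet (hd.trans h) m
  | add _ _ ih₁ ih₂ => exact (ih₁ h).add (ih₂ h)
  | mul hF hG hr _ _ => exact hF.mul hG (hr.trans h)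

theorem const_mul {d : ℕ} {F : Conf → Mink → ℝ} (hF : IsJetPoly d F) (c : ℝ) :
    IsJetPoly d fun φ x => c * F φ x :=
  (const 0 c).mul hF (by simp)

theorem sub {d : ℕ} {F G : Conf → Mink → ℝ} (hF : IsJetPoly d F) (hG : IsJetPoly d G) :
    IsJetPoly d fun φ x => F φ x - G φ x := by
  simpa [sub_eq_add_neg] using hF.add (hG.const_mul (-1))

theorem sum {d : ℕ} {ι : Type*} (s : Finset ι) {F : ι → Conf → Mink → ℝ}
    (hF : ∀ i ∈ s, IsJetPoly d (F i)) : IsJetPoly d fun φ x => ∑ i ∈ s, F i φ x := by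
  classical
  induction s using Finset.induction_on with
  | empty => simpa using const d 0
  | insert i s hi ih =>
    simp_rw [Finset.sum_insert hi]
    exact (hF i (Finset.mem_insert_self i s)).add
      (ih fun j hj => hF j (Finset.mem_insert_of_mem hj))

theorem contDiff {d : ℕ} {F : Conf → Mink → ℝ} (hF : IsJetPoly d F) (φ : Conf) :
    ContDiff ℝ ∞ (F φ) := by
  induction hF with
  | const d c => exact contDiff_const
  | jet hd m => exact contDiff_jet m φ
  | add _ _ ih₁ ih₂ => exact ih₁.add ih₂
  | mul _ _ _ ih₁ ih₂ => exact ih₁.mul ih₂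

/-- Differentiation raises the order of the jets but, by the product rule, not the degree. -/
theorem dXi {d : ℕ} {F : Conf → Mink → ℝ} (hF : IsJetPoly d F) :
    IsJetPoly d fun φ => SineGordon.dXi (F φ) := by
  induction hF with
  | const d c =>
    have : SineGordon.dXi (fun _ => c) = fun _ => 0 := by
      funext x
      simp [SineGordon.dXi]
    simp_rw [this]
    exact const d 0
  | jet hd m =>
    have : ∀ φ, SineGordon.dXi (fun x => SineGordon.jet m x φ) =
      fun x => SineGordon.jet (m + 1) x φ := fun φ => (jet_succ m φ).symm
    simp_rw [this]
    exact jet hd (m + 1)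
  | @add d F G hF hG ih₁ ih₂ =>
    have : ∀ φ, SineGordon.dXi (fun x => F φ x + G φ x) =
        fun x => SineGordon.dXi (F φ) x + SineGordon.dXi (G φ) x := by
      intro φ
      rw [dXi_eq_fderiv (hF.contDiff φ), dXi_eq_fderiv (hG.contDiff φ),
        dXi_eq_fderiv ((hF.contDiff φ).add (hG.contDiff φ))]
      funext x
      rw [fderiv_fun_add ((hF.contDiff φ).differentiable (by simp) x)
        ((hG.contDiff φ).differentiable (by simp) x)]
      rfl
    simp_rw [this]
    exact ih₁.add ih₂
  | @mul d e r F G hF hG hr ih₁ ih₂ =>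
    have : ∀ φ, SineGordon.dXi (fun x => F φ x * G φ x) =
        fun x => F φ x * SineGordon.dXi (G φ) x + SineGordon.dXi (F φ) x * G φ x := by
      intro φ
      rw [dXi_eq_fderiv (hF.contDiff φ), dXi_eq_fderiv (hG.contDiff φ),
        dXi_eq_fderiv ((hF.contDiff φ).mul (hG.contDiff φ))]
      funext x
      rw [fderiv_fun_mul ((hF.contDiff φ).differentiable (by simp) x)
        ((hG.contDiff φ).differentiable (by simp) x)]
      simp [mul_comm]
    simp_rw [this]
    exact (hF.mul ih₂ hr).add (ih₁.mul hG hr)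

theorem coeff_pow {B : Conf → PowerSeries (Mink → ℝ)}
    (hB : ∀ k, IsJetPoly k fun φ => PowerSeries.coeff k (B φ)) (d n : ℕ) :
    IsJetPoly n fun φ => PowerSeries.coeff n (B φ ^ d) := by
  induction d generalizing n with
  | zero =>
    have : ∀ φ, PowerSeries.coeff n (B φ ^ 0) = fun _ => if n = 0 then 1 else 0 := by
      intro φ
      rw [pow_zero, PowerSeries.coeff_one]
      funext x
      split_ifs <;> rfl
    simp_rw [this]
    exact const n _
  | succ d ih =>
    have : ∀ φ, PowerSeries.coeff n (B φ ^ (d + 1)) = fun x =>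
        ∑ p ∈ Finset.HasAntidiagonal.antidiagonal n, PowerSeries.coeff p.1 (B φ ^ d) x * PowerSeries.coeff p.2 (B φ) x := by
      intro φ
      rw [pow_succ, PowerSeries.coeff_mul]
      funext x
      rw [Finset.sum_apply]
      rfl
    simp_rw [this]
    refine sum _ fun p hp => (ih p.1).mul (hB p.2) ?_
    rw [Finset.HasAntidiagonal.mem_antidiagonal] at hp
    exact hp.le

/-- The grading "coefficient k has degree at most k" is stable under Cauchy products. The vanishing
constant term of B makes B^d divisible by X^d, so only the powers d ≤ n contribute. -/
theorem coeff_subst {S : PowerSeries (Mink → ℝ)} {s : ℕ → ℝ}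
    (hS : ∀ d x, PowerSeries.coeff d S x = s d) {B : Conf → PowerSeries (Mink → ℝ)}
    (hB0 : ∀ φ, PowerSeries.constantCoeff (B φ) = 0)
    (hB : ∀ k, IsJetPoly k fun φ => PowerSeries.coeff k (B φ)) (n : ℕ) :
    IsJetPoly n fun φ => PowerSeries.coeff n (S.subst (B φ)) := by
  have : ∀ φ, PowerSeries.coeff n (S.subst (B φ)) = fun x =>
      ∑ d ∈ Finset.range (n + 1), s d * PowerSeries.coeff n (B φ ^ d) x := by
    intro φ
    rw [PowerSeries.coeff_subst' (PowerSeries.HasSubst.of_constantCoeff_zero' (hB0 φ)),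
      finsum_eq_sum_of_support_subset (s := Finset.range (n + 1))]
    · funext x
      rw [Finset.sum_apply]
      refine Finset.sum_congr rfl fun d _ => ?_
      rw [← hS d x]
      rfl
    · intro d hd
      rw [Finset.coe_range, Set.mem_Iio]
      by_contra hlt
      have hX : (PowerSeries.X : PowerSeries (Mink → ℝ)) ^ d ∣ B φ ^ d :=
        pow_dvd_pow_of_dvd (PowerSeries.X_dvd_iff.2 (hB0 φ)) d
      refine hd ?_
      simp only
      rw [PowerSeries.X_pow_dvd_iff.1 hX n (by omega), smul_zero]
  simp_rw [this]
  exact sum _ fun d _ => (coeff_pow hB d n).const_mul _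

end IsJetPoly

theorem exists_coeff_sin : ∃ s : ℕ → ℝ, ∀ d (x : Mink),
    PowerSeries.coeff d (PowerSeries.sin (Mink → ℝ)) x = s d := by
  refine ⟨fun d => if Even d then 0 else algebraMap ℚ ℝ ((-1) ^ (d / 2) / d.factorial), fun d x => ?_⟩
  rw [PowerSeries.sin, PowerSeries.coeff_mk]
  beta_reduce
  split_ifs <;> rfl

theorem exists_coeff_cos : ∃ s : ℕ → ℝ, ∀ d (x : Mink),
    PowerSeries.coeff d (PowerSeries.cos (Mink → ℝ)) x = s d := by
  refine ⟨fun d => if Even d then algebraMap ℚ ℝ ((-1) ^ (d / 2) / d.factorial) else 0, fun d x => ?_⟩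
  rw [PowerSeries.cos, PowerSeries.coeff_mk]
  beta_reduce
  split_ifs <;> rfl

theorem backlundSeries_spec {a : ℝ} (ha : a ≠ 0) (φ : Mink → ℝ) :
    IsBacklundSeries a φ (backlundSeries a φ) := by
  have h := (existsUnique_backlundSeries ha φ).exists
  rw [backlundSeries, dif_pos h]
  exact h.choose_spec

theorem coeff_zero_backlundSeries {a : ℝ} (ha : a ≠ 0) (φ : Mink → ℝ) :
    PowerSeries.coeff 0 (backlundSeries a φ) = φ :=
  (backlundSeries_spec ha φ).1

/-- Induction along the recursion: A_{n+1} is built from the ξ-derivative of A_n and from the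
coefficient of order n + 1 of a sine whose argument involves only A_1, …, A_n. The coefficient A_0 =
φ has degree 1 rather than 0 and is excluded; it cancels in the argument of the sine. -/
theorem isJetPoly_coeff_backlundSeries {a : ℝ} (ha : a ≠ 0) (n : ℕ) (hn : 1 ≤ n) :
    IsJetPoly n fun φ => PowerSeries.coeff n (backlundSeries a φ.1) := by
  induction n using Nat.strong_induction_on with
  | _ n ih =>
    obtain ⟨n, rfl⟩ : ∃ m, n = m + 1 := ⟨n - 1, by omega⟩
    let A : Conf → ℕ → Mink → ℝ := fun φ k => PowerSeries.coeff k (backlundSeries a φ.1)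
    have hrec : ∀ φ, A φ (n + 1) = fun x => (2 / a) * (SineGordon.dXi (fun x => (1 / 2) * (A φ n x +
        if n = 0 then φ.1 x else 0)) x - PowerSeries.coeff (n + 1)
          ((PowerSeries.sin (Mink → ℝ)).subst (backlundPart a (n + 1) (A φ))) x) := by
      intro φ
      have hmk : PowerSeries.mk (A φ) = backlundSeries a φ.1 := by
        ext1 k
        rw [PowerSeries.coeff_mk]
      have h := ((isBacklundSeries_iff ha φ.1 (A φ)).1 (hmk ▸ backlundSeries_spec ha φ.1)).2 n
      rw [h]
      have h2 : ((1 / 2 : ℝ) • (A φ n + if n = 0 then φ.1 else 0)) =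
          fun x => (1 / 2) * (A φ n x + if n = 0 then φ.1 x else 0) := by
        funext x
        split_ifs <;> rfl
      rw [h2]
      rfl
    change IsJetPoly (n + 1) fun φ => A φ (n + 1)
    simp_rw [hrec]
    refine ((IsJetPoly.dXi (IsJetPoly.const_mul ?_ _)).sub ?_).const_mul _
    · by_cases h0 : n = 0
      · subst h0
        simp only [if_true]
        have h : ∀ φ, A φ 0 = φ.1 := fun φ => coeff_zero_backlundSeries ha φ.1
        simp_rw [h]
        exact (IsJetPoly.jet le_rfl 0).add (IsJetPoly.jet le_rfl 0)
      · simp only [if_neg h0, add_zero]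
        exact (ih n (Nat.lt_succ_self n) (by omega)).mono (Nat.le_succ n)
    · obtain ⟨s, hs⟩ := exists_coeff_sin
      have hcoeff : ∀ k φ, PowerSeries.coeff k (backlundPart a (n + 1) (A φ)) =
          if 1 ≤ k ∧ k < n + 1 then fun x => (a / 2) * A φ k x else fun _ => 0 := by
        intro k φ
        rw [backlundPart, PowerSeries.coeff_mk]
        by_cases hk : k < n + 1
        · by_cases hk0 : k = 0
          · simp [hk0]
            rfl
          · simp only [hk, if_true, hk0, if_false, sub_zero]
            rw [if_pos ⟨by omega, trivial⟩]
            rfl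
        · simp only [hk, if_false, and_false]
          rfl
      refine IsJetPoly.coeff_subst hs (fun φ => ?_) (fun k => ?_) (n + 1)
      · rw [← PowerSeries.coeff_zero_eq_constantCoeff_apply, hcoeff, if_neg (by simp)]
        rfl
      · simp_rw [hcoeff]
        split_ifs with h
        · exact (ih k h.2 h.1).const_mul _
        · exact IsJetPoly.const k 0

/-- The arguments of both cosines have no term of order 0, since A_0 = φ. With n = 2N + 2 this is
the source of the upper limit 2(N + 1) of the expansion. -/
theorem isJetPoly_coeff_currentSeries {a : ℝ} (ha : a ≠ 0) (n : ℕ) :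
    IsJetPoly n fun φ => PowerSeries.coeff n (currentSeries a φ.1) := by
  obtain ⟨s, hs⟩ := exists_coeff_cos
  have hexp : ∀ φ : Conf, PowerSeries.coeff n (currentSeries a φ.1) = fun x =>
      (if n = 0 then 2 else 0) - PowerSeries.coeff n ((PowerSeries.cos (Mink → ℝ)).subst ((a / 2 : ℝ) •
        (PowerSeries.C φ.1 - PowerSeries.rescale (-1 : Mink → ℝ) (backlundSeries a φ.1)))) x
      - PowerSeries.coeff n ((PowerSeries.cos (Mink → ℝ)).subst ((a / 2 : ℝ) •
        (PowerSeries.C φ.1 - backlundSeries a φ.1))) x := by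
    intro φ
    rw [currentSeries, map_sub, map_sub]
    have : (2 : PowerSeries (Mink → ℝ)) = PowerSeries.C 2 := (map_ofNat PowerSeries.C 2).symm
    rw [this, PowerSeries.coeff_C]
    funext x
    split_ifs <;> rfl
  simp_rw [hexp]
  -- Both cosines at once: rescaling by c = -1 gives the first, by c = 1 the second.
  have hone : ∀ c : ℝ, IsJetPoly n fun φ => PowerSeries.coeff n ((PowerSeries.cos (Mink → ℝ)).subst
      ((a / 2 : ℝ) • (PowerSeries.C φ.1 -
        PowerSeries.rescale (fun _ => c : Mink → ℝ) (backlundSeries a φ.1)))) := by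
    intro c
    have hcoeff : ∀ k (φ : Conf), PowerSeries.coeff k ((a / 2 : ℝ) • (PowerSeries.C φ.1 -
        PowerSeries.rescale (fun _ => c : Mink → ℝ) (backlundSeries a φ.1))) =
        if k = 0 then fun _ => 0 else fun x =>
          (-(a / 2) * c ^ k) * PowerSeries.coeff k (backlundSeries a φ.1) x := by
      intro k φ
      rw [PowerSeries.coeff_smul, map_sub, PowerSeries.coeff_rescale, PowerSeries.coeff_C]
      by_cases hk : k = 0
      · subst hk
        rw [coeff_zero_backlundSeries ha]
        simp
        rfl
      · simp only [hk, if_false]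
        funext x
        simp
        ring
    refine IsJetPoly.coeff_subst hs (fun φ => ?_) (fun k => ?_) n
    · rw [← PowerSeries.coeff_zero_eq_constantCoeff_apply, hcoeff, if_pos rfl]
      rfl
    · simp_rw [hcoeff]
      split_ifs with h
      · exact IsJetPoly.const k 0
      · exact (isJetPoly_coeff_backlundSeries ha k (by omega)).const_mul _
  refine ((IsJetPoly.const n _).sub ?_).sub ?_
  · exact hone (-1)
  · have h1 : (fun _ => 1 : Mink → ℝ) = 1 := rfl
    have := hone 1
    simp_rw [h1, PowerSeries.rescale_one] at this
    exact this

/-! ### Functional derivatives of polynomials in jets -/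

theorem pderiv_comm {σ R : Type*} [CommSemiring R] (i j : σ) (P : MvPolynomial σ R) :
    MvPolynomial.pderiv i (MvPolynomial.pderiv j P) =
      MvPolynomial.pderiv j (MvPolynomial.pderiv i P) := by
  classical
  ext m
  simp only [MvPolynomial.coeff_pderiv]
  rcases eq_or_ne i j with rfl | h
  · rfl
  · simp only [add_right_comm m, Finsupp.add_apply, Finsupp.single_eq_of_ne h,
      Finsupp.single_eq_of_ne h.symm, add_zero]
    ring

theorem totalDegree_pderiv_le {σ R : Type*} [CommSemiring R] (i : σ) {P : MvPolynomial σ R} {d : ℕ}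
    (hP : P.totalDegree ≤ d + 1) : (MvPolynomial.pderiv i P).totalDegree ≤ d := by
  refine Finset.sup_le fun m hm => ?_
  rw [MvPolynomial.mem_support_iff, MvPolynomial.coeff_pderiv] at hm
  have h := (MvPolynomial.le_totalDegree
    (MvPolynomial.mem_support_iff.2 (left_ne_zero_of_mul hm))).trans hP
  rw [Finsupp.sum_add_index' (fun _ => rfl) (fun _ _ _ => rfl), Finsupp.sum_single_index rfl] at h
  exact Nat.le_of_succ_le_succ h

/-- Iterated partial derivatives. -/
def iterPderiv {σ : Type*} (L : List σ) (P : MvPolynomial σ ℝ) : MvPolynomial σ ℝ :=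
  L.foldr (fun i Q => MvPolynomial.pderiv i Q) P

theorem iterPderiv_perm {σ : Type*} {L L' : List σ} (h : L.Perm L') (P : MvPolynomial σ ℝ) :
    iterPderiv L P = iterPderiv L' P := by
  unfold iterPderiv
  exact h.foldr_eq' (fun i _ j _ Q => pderiv_comm j i Q) P

theorem iterPderiv_eq_zero {σ : Type*} {L : List σ} {P : MvPolynomial σ ℝ} {d : ℕ}
    (hP : P.totalDegree ≤ d) (hL : d < L.length) : iterPderiv L P = 0 := by
  induction d generalizing P L with
  | zero =>
    obtain ⟨c, rfl⟩ : ∃ c, P = MvPolynomial.C c :=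
      ⟨_, MvPolynomial.totalDegree_eq_zero_iff_eq_C.1 (Nat.le_zero.1 hP)⟩
    -- The right fold applies the last entry of the list first, so the list is split at its end.
    rcases L.eq_nil_or_concat with rfl | ⟨L, i, rfl⟩
    · simp at hL
    · rw [iterPderiv, List.concat_eq_append, List.foldr_append]
      simp only [List.foldr_cons, List.foldr_nil, MvPolynomial.pderiv_C]
      clear hL hP
      induction L with
      | nil => rfl
      | cons j L ih => rw [List.foldr_cons, ih, map_zero]
  | succ d ih =>
    rcases L.eq_nil_or_concat with rfl | ⟨L, i, rfl⟩
    · simp at hL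
    · rw [iterPderiv, List.concat_eq_append, List.foldr_append]
      exact ih (totalDegree_pderiv_le i hP) (by simpa using hL)

theorem hasDerivAt_eval {σ : Type*} [Fintype σ] (u w : σ → ℝ) (Q : MvPolynomial σ ℝ) :
    HasDerivAt (fun t : ℝ => MvPolynomial.eval (fun i => u i + t * w i) Q)
      (∑ i, MvPolynomial.eval u (MvPolynomial.pderiv i Q) * w i) 0 := by
  classical
  induction Q using MvPolynomial.induction_on with
  | C c => simpa using hasDerivAt_const (0 : ℝ) c
  | add P Q hP hQ =>
    simp only [map_add, add_mul, Finset.sum_add_distrib]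
    exact hP.add hQ
  | mul_X P j hP =>
    have hX : HasDerivAt (fun t : ℝ => u j + t * w j) (w j) 0 := by
      simpa using ((hasDerivAt_id (0 : ℝ)).mul_const (w j)).const_add (u j)
    simp only [map_mul, MvPolynomial.eval_X]
    refine (hP.mul hX).congr_deriv ?_
    simp only [zero_mul, add_zero, MvPolynomial.pderiv_mul, MvPolynomial.pderiv_X, map_add, map_mul,
      MvPolynomial.eval_X, add_mul, Finset.sum_add_distrib]
    congr 1
    · rw [Finset.sum_mul]
      exact Finset.sum_congr rfl fun i _ => by ring
    · rw [Finset.sum_eq_single j]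
      · simp
      · intro i _ hij
        simp [hij.symm]
      · simp

/-- Every sufficiently large number of variables is allowed, so that two fields can be written with
the same variables before they are added or multiplied. -/
theorem IsJetPoly.exists_mvPolynomial {d : ℕ} {F : Conf → Mink → ℝ} (hF : IsJetPoly d F) :
    ∃ M₀ : ℕ, ∀ M ≥ M₀, ∃ P : MvPolynomial (Fin M) ℝ, P.totalDegree ≤ d ∧
      ∀ φ x, F φ x = MvPolynomial.eval (fun i : Fin M => SineGordon.jet i x φ) P := by
  induction hF with
  | const d c => exact ⟨0, fun M _ => ⟨MvPolynomial.C c, by simp, by simp⟩⟩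
  | jet hd m =>
    exact ⟨m + 1, fun M hM => ⟨MvPolynomial.X ⟨m, hM⟩, by simpa using hd, by simp⟩⟩
  | add _ _ ih₁ ih₂ =>
    obtain ⟨M₁, h₁⟩ := ih₁
    obtain ⟨M₂, h₂⟩ := ih₂
    refine ⟨max M₁ M₂, fun M hM => ?_⟩
    obtain ⟨P, hP, hP'⟩ := h₁ M (le_trans (le_max_left _ _) hM)
    obtain ⟨Q, hQ, hQ'⟩ := h₂ M (le_trans (le_max_right _ _) hM)
    exact ⟨P + Q, (MvPolynomial.totalDegree_add P Q).trans (max_le hP hQ),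
      fun φ x => by simp only [hP', hQ', map_add]⟩
  | mul _ _ hr ih₁ ih₂ =>
    obtain ⟨M₁, h₁⟩ := ih₁
    obtain ⟨M₂, h₂⟩ := ih₂
    refine ⟨max M₁ M₂, fun M hM => ?_⟩
    obtain ⟨P, hP, hP'⟩ := h₁ M (le_trans (le_max_left _ _) hM)
    obtain ⟨Q, hQ, hQ'⟩ := h₂ M (le_trans (le_max_right _ _) hM)
    exact ⟨P * Q, (MvPolynomial.totalDegree_mul P Q).trans ((add_le_add hP hQ).trans hr),
      fun φ x => by simp only [hP', hQ', map_mul]⟩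

theorem funcDeriv_eval_jet {M : ℕ} (P : MvPolynomial (Fin M) ℝ) (x : Mink) (n : ℕ)
    (h : Fin n → Conf) :
    funcDeriv n h (fun φ => ((MvPolynomial.eval (fun i : Fin M => jet i x φ) P : ℝ) : ℂ)) =
      fun φ => ∑ κ : Fin n → Fin M,
        ((MvPolynomial.eval (fun i : Fin M => jet i x φ) (iterPderiv (List.ofFn κ) P) : ℝ) : ℂ) *
          ∏ i, (jet (κ i) x (h i) : ℂ) := by
  induction n with
  | zero =>
    funext φ
    simp [funcDeriv, iterPderiv]
  | succ n ih =>
    rw [funcDeriv, ih]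
    funext φ
    have hd : ∀ κ : Fin n → Fin M, HasDerivAt (fun t : ℝ =>
        ((MvPolynomial.eval (fun i : Fin M => jet i x (φ + t • h 0))
          (iterPderiv (List.ofFn κ) P) : ℝ) : ℂ) * ∏ i : Fin n, (jet (κ i) x (h i.succ) : ℂ))
        (∑ m : Fin M, ((MvPolynomial.eval (fun i : Fin M => jet i x φ)
          (MvPolynomial.pderiv m (iterPderiv (List.ofFn κ) P)) : ℝ) : ℂ) *
            ((jet m x (h 0) : ℂ) * ∏ i : Fin n, (jet (κ i) x (h i.succ) : ℂ))) 0 := by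
      intro κ
      have h1 := (hasDerivAt_eval (fun i : Fin M => jet i x φ) (fun i => jet i x (h 0))
        (iterPderiv (List.ofFn κ) P)).ofReal_comp.mul_const
          (∏ i : Fin n, (jet (κ i) x (h i.succ) : ℂ))
      simp only [map_add, map_smul, smul_eq_mul]
      refine h1.congr_deriv ?_
      push_cast
      rw [Finset.sum_mul]
      exact Finset.sum_congr rfl fun m _ => by ring
    refine (HasDerivAt.fun_sum fun κ _ => hd κ).deriv.trans ?_
    rw [← (Fin.consEquiv fun _ : Fin (n + 1) => Fin M).sum_comp, Fintype.sum_prod_type_right]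
    refine Finset.sum_congr rfl fun κ _ => Finset.sum_congr rfl fun m _ => ?_
    simp only [Fin.consEquiv, Equiv.coe_fn_mk, Fin.prod_univ_succ, Fin.cons_zero, Fin.cons_succ,
      List.ofFn_succ]
    rfl

/-- The functional derivatives of `s₂^N` are symmetric, vanish for orders above `2N + 2`, and are
linear combinations of products of jets with smooth coefficients. -/
theorem exists_funcDeriv_s2 {a : ℝ} (ha : a ≠ 0) (N : ℕ) (φ : Conf) :
    ∃ (M : ℕ) (β : List (Fin M) → Mink → ℝ),
      (∀ n (h : Fin n → Conf) x, funcDeriv n h (s2 a N x) φ =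
        ∑ κ : Fin n → Fin M, (β (List.ofFn κ) x : ℂ) * ∏ i, (jet (κ i) x (h i) : ℂ)) ∧
      (∀ L L' : List (Fin M), L.Perm L' → β L = β L') ∧
      (∀ L : List (Fin M), 2 * N + 2 < L.length → β L = 0) ∧
      ∀ L, ContDiff ℝ ∞ (β L) := by
  obtain ⟨M, hM⟩ := (isJetPoly_coeff_currentSeries ha (2 * N + 2)).exists_mvPolynomial
  obtain ⟨P, hP, hPe⟩ := hM M le_rfl
  refine ⟨M, fun L x => MvPolynomial.eval (fun i : Fin M => jet i x φ) (iterPderiv L P),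
    ?_, ?_, ?_, ?_⟩
  · intro n h x
    have : s2 a N x = fun φ => ((MvPolynomial.eval (fun i : Fin M => jet i x φ) P : ℝ) : ℂ) := by
      funext φ
      rw [s2, hPe]
    rw [this, funcDeriv_eval_jet]
  · intro L L' h
    simp_rw [iterPderiv_perm h]
  · intro L hL
    funext x
    simp only [iterPderiv_eq_zero hP hL, map_zero]
    rfl
  · intro L
    change ContDiff ℝ ∞ fun x => MvPolynomial.eval (fun i : Fin M => jet i x φ) (iterPderiv L P)
    generalize iterPderiv L P = Q
    induction Q using MvPolynomial.induction_on with
    | C c => simpa using contDiff_const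
    | add P Q hP hQ => simpa using hP.add hQ
    | mul_X P i hP => simpa using hP.mul (contDiff_jet i φ)

/-! ### Sums over distributions of arguments -/

/-- The index of the block containing `k`, for consecutive blocks of lengths `J i`. -/
def blockIndex {l : ℕ} (J : Fin l → ℕ) (k : Fin (∑ i, J i)) : Fin l := (finSigmaFinEquiv.symm k).1

-- The coefficient of the monomial X^J in (X_1 + ⋯ + X_l)^n, computed twice: it is a multinomial
-- coefficient, and it counts the maps whose fibres have sizes J.
open Finset in
theorem card_fiber_mul_prod_factorial {l n : ℕ} {J : Fin l → ℕ} (hJ : ∑ i, J i = n) :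
    #{f : Fin n → Fin l | ∀ i, #{k | f k = i} = J i} * ∏ i, (J i).factorial = n.factorial := by
  let d : Fin l →₀ ℕ := Finsupp.equivFunOnFinite.symm J
  have hd : ∀ i, d i = J i := fun i => rfl
  have hs : (d.sum fun _ m => m) = n := by
    rw [Finsupp.sum_fintype _ _ fun _ => rfl, ← hJ]
    rfl
  have h1 := MvPolynomial.coeff_sum_X_pow_of_fintype (R := ℕ) d n
  rw [if_pos hs, ← Finsupp.multinomial_of_support_subset (Finset.subset_univ _), Fintype.sum_pow,
    MvPolynomial.coeff_sum] at h1
  have h2 : ∀ f : Fin n → Fin l,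
      MvPolynomial.coeff d (∏ k, (MvPolynomial.X (f k) : MvPolynomial (Fin l) ℕ)) =
        if ∀ i, #{k | f k = i} = J i then 1 else 0 := by
    intro f
    have hf : (∏ k, (MvPolynomial.X (f k) : MvPolynomial (Fin l) ℕ)) =
        MvPolynomial.monomial (∑ k, Finsupp.single (f k) 1) 1 := by
      rw [← Finset.prod_const_one (s := (Finset.univ : Finset (Fin n))), MvPolynomial.monomial_sum_prod]
      simp [MvPolynomial.X]
    rw [hf, MvPolynomial.coeff_monomial]
    congr 1
    rw [Finsupp.ext_iff, eq_iff_iff]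
    refine forall_congr' fun i => ?_
    rw [Finsupp.finsetSum_apply, hd, Finset.card_filter]
    simp [Finsupp.single_apply]
  simp_rw [h2] at h1
  rw [Finset.sum_boole] at h1
  simp only [Nat.cast_id] at h1
  rw [h1, mul_comm, ← hJ]
  exact Nat.multinomial_spec _ _

open Finset in
theorem exists_equiv_blockIndex {l n : ℕ} {J : Fin l → ℕ} {f : Fin n → Fin l}
    (hf : ∀ i, #{k | f k = i} = J i) : ∃ e : Fin n ≃ Fin (∑ i, J i), blockIndex J ∘ e = f := by
  have hc : ∀ i, Nonempty ({k // f k = i} ≃ Fin (J i)) := fun i => by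
    rw [← Fintype.card_eq, Fintype.card_fin, Fintype.card_subtype, hf]
  let e := ((Equiv.sigmaFiberEquiv f).symm.trans
    (Equiv.sigmaCongrRight fun i => (hc i).some)).trans finSigmaFinEquiv
  refine ⟨e, funext fun k => ?_⟩
  simp [e, blockIndex]

/-- A sum over all maps of a symmetric expression, sorted by the cardinalities of the fibers. -/
theorem sum_pi_eq_sum_finAntidiagonal {l : ℕ} (W : ∀ n, (Fin n → Fin l) → ℂ)
    (hW : ∀ n n' (e : Fin n ≃ Fin n') f, W n (f ∘ e) = W n' f) (n : ℕ) :
    ((n.factorial : ℂ))⁻¹ * ∑ f, W n f = ∑ J ∈ Finset.finAntidiagonal l n,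
      (∏ i, ((J i).factorial : ℂ))⁻¹ * W (∑ i, J i) (blockIndex J) := by
  classical
  have hmaps : ∀ f ∈ (Finset.univ : Finset (Fin n → Fin l)),
      (fun i => (Finset.univ.filter fun k => f k = i).card) ∈ Finset.finAntidiagonal l n := by
    intro f _
    rw [Finset.mem_finAntidiagonal, ← Finset.card_eq_sum_card_fiberwise fun _ _ => Finset.mem_univ _]
    simp
  rw [← Finset.sum_fiberwise_of_maps_to hmaps, Finset.mul_sum]
  refine Finset.sum_congr rfl fun J hJ => ?_
  rw [Finset.mem_finAntidiagonal] at hJ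
  rw [Finset.sum_congr rfl (g := fun _ => W (∑ i, J i) (blockIndex J))]
  · rw [Finset.sum_const, nsmul_eq_mul]
    have h := card_fiber_mul_prod_factorial hJ
    have h1 : (n.factorial : ℂ) ≠ 0 := by exact_mod_cast n.factorial_ne_zero
    have h2 : (∏ i, ((J i).factorial : ℂ)) ≠ 0 :=
      Finset.prod_ne_zero_iff.2 fun i _ => by exact_mod_cast (J i).factorial_ne_zero
    have h3 : (((Finset.univ.filter fun f : Fin n → Fin l =>
        (fun i => (Finset.univ.filter fun k => f k = i).card) = J).card : ℕ) : ℂ) *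
          ∏ i, ((J i).factorial : ℂ) = n.factorial := by
      rw [← h]
      push_cast
      simp only [funext_iff]
    rw [← mul_assoc]
    congr 1
    rw [← h3]
    -- The number of maps with fibre sizes J is nonzero because its product with the factorials is
    -- n!.
    have h4 := left_ne_zero_of_mul (h3.symm ▸ h1)
    field_simp
  · intro f hf
    obtain ⟨e, he⟩ := exists_equiv_blockIndex (congrFun (Finset.mem_filter.1 hf).2)
    rw [← he]
    exact hW _ _ e _

/-! ### Linear combinations of boundary values -/

/-- The kernels are continuous for `ε > 0` and have the boundary value `u`. -/
def IsContinuousBoundaryValue {n : ℕ} (κ : ℝ → (Fin n → Mink) → ℂ) (u : 𝓓'(offDiag n, ℂ)) : Prop :=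
  (∀ ε > 0, Continuous (κ ε)) ∧ IsBoundaryValue κ u

namespace IsContinuousBoundaryValue

variable {n : ℕ} {κ κ' : ℝ → (Fin n → Mink) → ℂ} {u u' : 𝓓'(offDiag n, ℂ)}

theorem congr (h : IsContinuousBoundaryValue κ u) (hκ : ∀ ε > 0, ∀ x, κ' ε x = κ ε x) :
    IsContinuousBoundaryValue κ' u := by
  have he : ∀ ε > 0, κ' ε = κ ε := fun ε hε => funext (hκ ε hε)
  refine ⟨fun ε hε => he ε hε ▸ h.1 ε hε, fun f => (h.2 f).congr' ?_⟩
  filter_upwards [self_mem_nhdsWithin] with ε hε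
  rw [he ε hε]

/-- Continuity for ε > 0 is carried along for this purpose: additivity of the integral needs
integrability of each summand. -/
theorem integrable (h : IsContinuousBoundaryValue κ u) {ε : ℝ} (hε : 0 < ε) (f : 𝓓(offDiag n, ℝ)) :
    Integrable fun x => κ ε x * (f x : ℂ) :=
  ((h.1 ε hε).mul (Complex.continuous_ofReal.comp f.continuous)).integrable_of_hasCompactSupport
    (f.hasCompactSupport.comp_left (g := Complex.ofReal) Complex.ofReal_zero).mul_left

theorem zero : IsContinuousBoundaryValue (n := n) (fun _ _ => 0) 0 := by
  refine ⟨fun _ _ => continuous_const, fun f => ?_⟩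
  simp

theorem add (h : IsContinuousBoundaryValue κ u) (h' : IsContinuousBoundaryValue κ' u') :
    IsContinuousBoundaryValue (fun ε x => κ ε x + κ' ε x) (u + u') := by
  refine ⟨fun ε hε => (h.1 ε hε).add (h'.1 ε hε), fun f => ((h.2 f).add (h'.2 f)).congr' ?_⟩
  filter_upwards [self_mem_nhdsWithin] with ε hε
  rw [← integral_add (h.integrable hε f) (h'.integrable hε f)]
  simp_rw [add_mul]

theorem smul (h : IsContinuousBoundaryValue κ u) (r : ℝ) :
    IsContinuousBoundaryValue (fun ε x => (r : ℂ) * κ ε x) (r • u) := by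
  refine ⟨fun ε hε => continuous_const.mul (h.1 ε hε), fun f => ((h.2 f).const_smul r).congr fun ε => ?_⟩
  simp_rw [mul_assoc]
  rw [integral_const_mul, Complex.real_smul]

theorem sum {ι : Type*} (s : Finset ι) {κ : ι → ℝ → (Fin n → Mink) → ℂ} {u : ι → 𝓓'(offDiag n, ℂ)}
    (h : ∀ i ∈ s, IsContinuousBoundaryValue (κ i) (u i)) :
    IsContinuousBoundaryValue (fun ε x => ∑ i ∈ s, κ i ε x) (∑ i ∈ s, u i) := by
  classical
  induction s using Finset.induction_on with
  | empty => simpa using zero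
  | insert i s hi ih =>
    simp_rw [Finset.sum_insert hi]
    exact (h i (Finset.mem_insert_self i s)).add
      (ih fun j hj => h j (Finset.mem_insert_of_mem hj))

end IsContinuousBoundaryValue

/-- Limits in ℂ are unique, so the chosen boundary value is the given one. -/
theorem boundaryValue_eq {n : ℕ} {κ : ℝ → (Fin n → Mink) → ℂ} {u : 𝓓'(offDiag n, ℂ)}
    (h : IsBoundaryValue κ u) : boundaryValue κ = u := by
  have hex : ∃ u, IsBoundaryValue κ u := ⟨u, h⟩
  rw [boundaryValue, dif_pos hex]
  exact DFunLike.ext _ _ fun f => tendsto_nhds_unique (hex.choose_spec f) (h f)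

/-! ### The regularised expansion -/

/-- The vertex operator parts of the regularised time-ordered products. -/
def vertexWeight (a : ℝ) (H : Mink → ℂ) {l : ℕ} (φ : Conf) (q : ℕ) (σ : Fin l → Bool)
    (x : Fin l → Mink) : ℂ :=
  (∏ _i : Fin l, (1 / 2 : ℂ)) * (vertexEnergy a H l σ x ^ q / (q.factorial : ℂ)) *
    Complex.exp ((∑ i, vertexExp a (σ i) (x i) : Conf →ₗ[ℝ] ℂ) φ)

/-- The contraction of a vertex operator at `x` with the `m`-th jet at `y`. -/
def vertexContraction (a μ ε : ℝ) (s : Bool) (m : ℕ) (x y : Mink) : ℂ :=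
  Complex.I * a * chargeSign s * ((-1) ^ m * propDeriv μ m ε (complexify (x - y)))

theorem hasContraction_vertexExp_feynman {μ : ℝ} (hμ : 0 < μ) {ε : ℝ} (hε : 0 < ε) (a : ℝ) (s : Bool)
    (m : ℕ) (x y : Mink) :
    HasContraction (feynman μ ε) (vertexExp a s x) (fun h => (jet m y h : ℂ))
      (vertexContraction a μ ε s m x y) := by
  have h := (hasContraction_feynman hμ hε m x y).const_mul (Complex.I * a * chargeSign s) 1
  simp only [one_mul, mul_one] at h
  exact h

/-- For fixed charges the factor i contributes one linear functional for each of its J i arguments.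
Regrouping these along the consecutive blocks gives a single product over all j arguments, to which
`pairing_eq_sum` applies. -/
theorem termKernel_eq {a μ : ℝ} (hμ : 0 < μ) (l N : ℕ) (φ : Conf) {M : ℕ} {β : List (Fin M) → Mink → ℝ}
    (hβ : ∀ n (h : Fin n → Conf) x, funcDeriv n h (s2 a N x) φ =
        ∑ κ : Fin n → Fin M, (β (List.ofFn κ) x : ℂ) * ∏ i, (jet (κ i) x (h i) : ℂ))
    (J : Fin l → ℕ) (q : ℕ) {ε : ℝ} (hε : 0 < ε) (x : Fin (l + 1) → Mink) :
    termKernel a μ l N φ J q ε x = ∑ σ : Fin l → Bool,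
      ∑ κ : Fin (∑ i, J i) → Fin M,
        vertexWeight a (feynman μ ε) φ q σ (fun i => x i.castSucc) * (β (List.ofFn κ) (x (Fin.last l)) : ℂ) *
          ∏ k, vertexContraction a μ ε (σ (blockIndex J k)) (κ k) (x (blockIndex J k).castSucc)
            (x (Fin.last l)) := by
  have hH : ∀ x y, HasContraction (feynman μ ε) (fun h => (h.1 x : ℂ)) (fun h => (h.1 y : ℂ))
      (feynman μ ε (x - y)) := by
    intro x y
    have h := hasContraction_feynman hμ hε 0 x y
    rw [← feynman_eq_propDeriv, pow_zero, one_mul] at h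
    exact h
  have hA : ∀ h : Fin (∑ i, J i) → Conf, PowerSeries.coeff q (timeOrdered (feynman μ ε) l fun i =>
      PowerSeries.C (funcDeriv (J i) (fun k => h (finSigmaFinEquiv ⟨i, k⟩)) (lInt a (x i.castSucc)))) φ =
      ∑ σ : Fin l → Bool, vertexWeight a (feynman μ ε) φ q σ (fun i => x i.castSucc) *
        ∏ k, vertexExp a (σ (blockIndex J k)) (x (blockIndex J k).castSucc) (h k) := by
    intro h
    simp_rw [funcDeriv_lInt]
    rw [coeff_timeOrdered hH a l (fun i s => (1 / 2 : ℂ) * ∏ k : Fin (J i),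
      vertexExp a s (x i.castSucc) (h (finSigmaFinEquiv ⟨i, k⟩)))]
    refine Finset.sum_congr rfl fun σ _ => ?_
    rw [← finSigmaFinEquiv.prod_comp, Fintype.prod_sigma, Finset.prod_mul_distrib, vertexWeight]
    simp only [blockIndex, Equiv.symm_apply_apply]
    ring
  rw [termKernel]
  exact pairing_eq_sum (H := feynman μ ε)
    (a := fun σ => vertexWeight a (feynman μ ε) φ q σ fun i => x i.castSucc)
    (D := fun σ k h => vertexExp a (σ (blockIndex J k)) (x (blockIndex J k).castSucc) h)
    (b := fun κ : Fin (∑ i, J i) → Fin M => (β (List.ofFn κ) (x (Fin.last l)) : ℂ))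
    (E := fun κ k h => (jet (κ k) (x (Fin.last l)) h : ℂ))
    (c := fun σ κ k => vertexContraction a μ ε (σ (blockIndex J k)) (κ k) (x (blockIndex J k).castSucc)
      (x (Fin.last l))) hA (fun h => hβ _ h _)
    (fun σ κ k => hasContraction_vertexExp_feynman hμ hε a (σ (blockIndex J k)) (κ k)
      (x (blockIndex J k).castSucc) (x (Fin.last l)))

theorem lhsKernel_eq_sum_pairing (a μ : ℝ) (l N : ℕ) (φ : Conf) (p : ℕ) (ε : ℝ)
    (x : Fin (l + 1) → Mink) :
    lhsKernel a μ l N φ p ε x = ∑ n ∈ Finset.range (p + 1), ((n.factorial : ℂ))⁻¹ *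
      pairing n (feynman μ ε) (fun h => funcDeriv n h (PowerSeries.coeff (p - n)
        (timeOrdered (feynman μ ε) l fun i => PowerSeries.C (lInt a (x i.castSucc)))) φ)
        (fun h => funcDeriv n h (s2 a N (x (Fin.last l))) φ) := by
  rw [lhsKernel, timeOrdered]
  simp only [Fin.snoc_castSucc, Fin.snoc_last]
  rw [coeff_star_C]

/-- The exponent of the product of vertex operators is a sum over vertices, so its n-th derivative
distributes the n propagators over the vertices in all ways. Sorting these ways by the number of
propagators per vertex gives the terms of the expansion. -/
theorem lhsKernel_eq {a μ : ℝ} (ha : a ≠ 0) (hμ : 0 < μ) (l N : ℕ) (φ : Conf) (p : ℕ) {ε : ℝ} (hε : 0 < ε)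
    (x : Fin (l + 1) → Mink) :
    lhsKernel a μ l N φ p ε x = ∑ j ∈ Finset.range (2 * (N + 1) + 1),
      if j ≤ p then ∑ J ∈ Finset.finAntidiagonal l j,
        (((∏ i, ((J i).factorial : ℝ))⁻¹ : ℝ) : ℂ) * termKernel a μ l N φ J (p - j) ε x else 0 := by
  obtain ⟨M, β, hβ, hperm, hzero, -⟩ := exists_funcDeriv_s2 ha N φ
  have hH : ∀ x y, HasContraction (feynman μ ε) (fun h => (h.1 x : ℂ)) (fun h => (h.1 y : ℂ))
      (feynman μ ε (x - y)) := by
    intro x y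
    have h := hasContraction_feynman hμ hε 0 x y
    rw [← feynman_eq_propDeriv, pow_zero, one_mul] at h
    exact h
  set y := x (Fin.last l) with hy
  -- The contribution, for fixed charges, of the assignment `f` of the n propagators to the
  -- vertices. Permutation invariance of `β` makes it independent of the labelling of the
  -- propagators.
  let W : (Fin l → Bool) → ∀ n, (Fin n → Fin l) → ℂ := fun σ n f =>
    ∑ κ : Fin n → Fin M, (β (List.ofFn κ) y : ℂ) *
      ∏ k, vertexContraction a μ ε (σ (f k)) (κ k) (x (f k).castSucc) y
  have hW : ∀ σ n n' (e : Fin n ≃ Fin n') f, W σ n (f ∘ e) = W σ n' f := by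
    intro σ n n' e f
    obtain rfl : n = n' := Fin.equiv_iff_eq.1 ⟨e⟩
    refine Fintype.sum_equiv (Equiv.arrowCongr e (Equiv.refl _)) _ _ fun κ => ?_
    congr 1
    · rw [hperm _ _ (Equiv.Perm.ofFn_comp_perm e.symm κ).symm]
      rfl
    · refine Fintype.prod_equiv e _ _ fun k => ?_
      simp [Equiv.arrowCongr]
  have hterm : ∀ (J : Fin l → ℕ) q, termKernel a μ l N φ J q ε x = ∑ σ : Fin l → Bool,
      vertexWeight a (feynman μ ε) φ q σ (fun i => x i.castSucc) * W σ (∑ i, J i) (blockIndex J) := by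
    intro J q
    rw [termKernel_eq hμ l N φ hβ J q hε x]
    refine Finset.sum_congr rfl fun σ _ => ?_
    simp only [W, Finset.mul_sum, mul_assoc, ← hy]
  have hn : ∀ n ∈ Finset.range (p + 1), ((n.factorial : ℂ))⁻¹ *
      pairing n (feynman μ ε) (fun h => funcDeriv n h (PowerSeries.coeff (p - n)
        (timeOrdered (feynman μ ε) l fun i => PowerSeries.C (lInt a (x i.castSucc)))) φ)
        (fun h => funcDeriv n h (s2 a N y) φ) =
      ∑ J ∈ Finset.finAntidiagonal l n,
        (((∏ i, ((J i).factorial : ℝ))⁻¹ : ℝ) : ℂ) * termKernel a μ l N φ J (p - n) ε x := by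
    intro n _
    simp_rw [lInt_eq_sum_exp]
    rw [coeff_timeOrdered hH a l (fun _ _ => (1 / 2 : ℂ)) (fun i => x i.castSucc) (p - n)]
    rw [pairing_sum_exp (H := feynman μ ε)
      (fun σ : Fin l → Bool => (∏ _i : Fin l, (1 / 2 : ℂ)) *
        (vertexEnergy a (feynman μ ε) l σ (fun i => x i.castSucc) ^ (p - n) / ((p - n).factorial : ℂ)))
      (fun σ => ∑ i, vertexExp a (σ i) (x i.castSucc)) (fun κ : Fin n → Fin M => (β (List.ofFn κ) y : ℂ))
      n (fun κ k h => (jet (κ k) y h : ℂ)) φ _ (fun h => hβ n h y)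
      (fun σ κ k => ∑ i, vertexContraction a μ ε (σ i) (κ k) (x i.castSucc) y)
      (fun σ κ k => hasContraction_sum_vertexExp a σ _ fun i => hasContraction_feynman hμ hε _ _ _)]
    -- Expanding the product over propagators of sums over vertices produces a sum over all maps f.
    have hσ : ∀ σ : Fin l → Bool, ∑ κ : Fin n → Fin M, (β (List.ofFn κ) y : ℂ) *
        ∏ k, ∑ i, vertexContraction a μ ε (σ i) (κ k) (x i.castSucc) y = ∑ f, W σ n f := by
      intro σ
      simp only [W]
      rw [Finset.sum_comm]
      refine Finset.sum_congr rfl fun κ _ => ?_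
      rw [Finset.prod_univ_sum, Fintype.piFinset_univ, Finset.mul_sum]
    calc _ = ∑ σ : Fin l → Bool, vertexWeight a (feynman μ ε) φ (p - n) σ (fun i => x i.castSucc) *
          (((n.factorial : ℂ))⁻¹ * ∑ f, W σ n f) := by
          rw [Finset.mul_sum]
          refine Finset.sum_congr rfl fun σ _ => ?_
          rw [← hσ, vertexWeight]
          simp only [Finset.mul_sum]
          refine Finset.sum_congr rfl fun κ _ => ?_
          ring
      _ = _ := by
          simp_rw [sum_pi_eq_sum_finAntidiagonal (W _) (hW _) n, hterm, Finset.mul_sum]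
          rw [Finset.sum_comm]
          refine Finset.sum_congr rfl fun J _ => Finset.sum_congr rfl fun σ _ => ?_
          push_cast
          ring
  rw [lhsKernel_eq_sum_pairing, Finset.sum_congr rfl hn]
  have hbig : ∀ j, 2 * (N + 1) < j → ∀ J ∈ Finset.finAntidiagonal l j, ∀ q,
      termKernel a μ l N φ J q ε x = 0 := by
    intro j hj J hJ q
    rw [Finset.mem_finAntidiagonal] at hJ
    rw [hterm]
    refine Finset.sum_eq_zero fun σ _ => ?_
    have : W σ (∑ i, J i) (blockIndex J) = 0 := by
      refine Finset.sum_eq_zero fun κ _ => ?_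
      rw [hzero _ (by rw [List.length_ofFn]; omega)]
      simp
    rw [this, mul_zero]
  let T : ℕ → ℂ := fun j => if j ≤ p then ∑ J ∈ Finset.finAntidiagonal l j,
    (((∏ i, ((J i).factorial : ℝ))⁻¹ : ℝ) : ℂ) * termKernel a μ l N φ J (p - j) ε x else 0
  -- Terms vanish for j > p by the order in ħ and for j > 2(N + 1) by the degree of s₂^N, so the two
  -- ranges of summation give the same value.
  have hT : ∀ j, (p < j ∨ 2 * (N + 1) < j) → T j = 0 := by
    rintro j (hj | hj)
    · exact if_neg (by omega)
    · simp only [T]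
      split_ifs
      · exact Finset.sum_eq_zero fun J hJ => by rw [hbig j hj J hJ, mul_zero]
      · rfl
  have hL : ∑ n ∈ Finset.range (p + 1), ∑ J ∈ Finset.finAntidiagonal l n,
      (((∏ i, ((J i).factorial : ℝ))⁻¹ : ℝ) : ℂ) * termKernel a μ l N φ J (p - n) ε x =
      ∑ j ∈ Finset.range (p + 1), T j :=
    Finset.sum_congr rfl fun j hj => (if_pos (Nat.lt_succ_iff.1 (Finset.mem_range.1 hj))).symm
  rw [hL]
  change ∑ j ∈ Finset.range (p + 1), T j = ∑ j ∈ Finset.range (2 * (N + 1) + 1), T j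
  have hsub : ∀ A, (∀ j, A ≤ j → T j = 0) → ∀ B, A ≤ B →
      ∑ j ∈ Finset.range A, T j = ∑ j ∈ Finset.range B, T j := fun A hA B hAB =>
    Finset.sum_subset (Finset.range_mono hAB) fun j _ hj => hA j (by simpa using hj)
  rcases le_total (p + 1) (2 * (N + 1) + 1) with h | h
  · exact hsub _ (fun j hj => hT j (Or.inl hj)) _ h
  · exact (hsub _ (fun j hj => hT j (Or.inr hj)) _ h).symm

/-! ### Existence of the boundary values -/

theorem propDeriv_complexify_sub {n : ℕ} (μ : ℝ) (m : ℕ) (ε : ℝ) (x : Fin n → Mink) (i j : Fin n) :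
    propDeriv μ m ε (complexify (x i - x j)) =
      propDeriv μ m ε (wickTuple 0 x i - wickTuple 0 x j) := by
  rw [wickTuple_apply, wickTuple_apply, ← map_sub, wickCLM_zero]

/-- The injection `e` places the vertices among a larger tuple, which already contains the point of
s₂^N. Its injectivity ensures that every propagator joins distinct points, as
`isWickRotatable_propDeriv` requires. -/
theorem exists_isWickRotatable_vertexEnergy (a : ℝ) {μ : ℝ} (hμ : 0 < μ) {n : ℕ} (l : ℕ)
    (σ : Fin l → Bool) {e : Fin l → Fin n} (he : Function.Injective e) :
    ∃ k : ℝ → (Fin n → ℂ × ℂ) → ℂ, IsWickRotatable k ∧ ∀ ε x,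
      vertexEnergy a (feynman μ ε) l σ (fun i => x (e i)) = k ε (wickTuple 0 x) := by
  induction l with
  | zero => exact ⟨fun _ _ => 0, .const 0, fun _ _ => rfl⟩
  | succ l ih =>
    obtain ⟨k, hk, hke⟩ := ih (fun i => σ i.castSucc) (e := fun i => e i.castSucc)
      (he.comp (Fin.castSucc_injective l))
    refine ⟨_, hk.add (.sum Finset.univ fun i _ => (IsWickRotatable.const
      (Complex.I * a * chargeSign (σ (Fin.castSucc i)) * (Complex.I * a * chargeSign (σ (Fin.last l))))).mul
      (isWickRotatable_propDeriv hμ 0 (i := e (Fin.castSucc i)) (j := e (Fin.last l))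
        (he.ne (Fin.castSucc_lt_last i).ne))), fun ε x => ?_⟩
    rw [vertexEnergy, hke]
    simp only [feynman_eq_propDeriv, propDeriv_complexify_sub]

/-- Each summand of `termKernel_eq` splits into a smooth factor depending on φ and a polynomial in
propagators and their ξ-derivatives between distinct points. Only the latter is singular, and it is
Wick rotatable. -/
theorem exists_isContinuousBoundaryValue_termKernel {a μ : ℝ} (ha : a ≠ 0) (hμ : 0 < μ) (l N : ℕ) (φ : Conf)
    (J : Fin l → ℕ) (q : ℕ) : ∃ u, IsContinuousBoundaryValue (termKernel a μ l N φ J q) u := by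
  obtain ⟨M, β, hβ, -, -, hsmooth⟩ := exists_funcDeriv_s2 ha N φ
  have hone : ∀ (σ : Fin l → Bool) (κ : Fin (∑ i, J i) → Fin M), ∃ u, IsContinuousBoundaryValue
      (fun ε (x : Fin (l + 1) → Mink) => vertexWeight a (feynman μ ε) φ q σ (fun i => x i.castSucc) *
        (β (List.ofFn κ) (x (Fin.last l)) : ℂ) *
          ∏ k, vertexContraction a μ ε (σ (blockIndex J k)) (κ k) (x (blockIndex J k).castSucc)
            (x (Fin.last l))) u := by
    intro σ κ
    obtain ⟨k, hk, hke⟩ := exists_isWickRotatable_vertexEnergy a hμ l σ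
      (e := Fin.castSucc) (Fin.castSucc_injective l)
    let b : (Fin (l + 1) → Mink) → ℂ := fun x =>
      Complex.exp ((∑ i, vertexExp a (σ i) (x i.castSucc) : Conf →ₗ[ℝ] ℂ) φ) *
        (β (List.ofFn κ) (x (Fin.last l)) : ℂ)
    have hb : ContDiff ℝ ∞ b := by
      refine ContDiff.mul (ContDiff.cexp ?_) ?_
      · simp only [LinearMap.sum_apply, vertexExp_apply]
        exact ContDiff.sum fun i _ => contDiff_const.mul
          (Complex.ofRealCLM.contDiff.comp (φ.contDiff.comp (contDiff_apply ℝ Mink i.castSucc)))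
      · exact Complex.ofRealCLM.contDiff.comp
          ((hsmooth _).comp (contDiff_apply ℝ Mink (Fin.last l)))
    have hw := (((IsWickRotatable.const (∏ _i : Fin l, (1 / 2 : ℂ))).mul
      (hk.pow q)).mul (.const ((q.factorial : ℂ))⁻¹)).mul
        (.prod Finset.univ fun k _ => (IsWickRotatable.const
          (Complex.I * a * chargeSign (σ (blockIndex J k)) * (-1) ^ (κ k : ℕ))).mul
          (isWickRotatable_propDeriv hμ (κ k) (i := (blockIndex J k).castSucc) (j := Fin.last l)
            (Fin.castSucc_lt_last _).ne))
    obtain ⟨hc, u, hu⟩ := hw.hasBoundaryValue hb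
    refine ⟨u, IsContinuousBoundaryValue.congr ⟨hc, hu⟩ fun ε _ x => ?_⟩
    simp only [vertexWeight, vertexContraction, hke, propDeriv_complexify_sub, b, div_eq_mul_inv,
      ← mul_assoc]
    ring
  choose u hu using hone
  exact ⟨_, (IsContinuousBoundaryValue.sum Finset.univ fun σ _ =>
    IsContinuousBoundaryValue.sum Finset.univ fun κ _ => hu σ κ).congr fun ε hε x =>
      termKernel_eq hμ l N φ hβ J q hε x⟩

theorem isContinuousBoundaryValue_unrenormTerm {a μ : ℝ} (ha : a ≠ 0) (hμ : 0 < μ) (l N : ℕ) (φ : Conf)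
    (J : Fin l → ℕ) (q : ℕ) :
    IsContinuousBoundaryValue (termKernel a μ l N φ J q) (unrenormTerm a μ l N φ J q) := by
  obtain ⟨u, hu⟩ := exists_isContinuousBoundaryValue_termKernel ha hμ l N φ J q
  rwa [unrenormTerm, boundaryValue_eq hu.2]

/-- The regularised identity writes the left-hand kernel as a finite linear combination of kernels
with known boundary values. Existence of its limit and the expansion follow together. -/
theorem isContinuousBoundaryValue_lhsKernel {a μ : ℝ} (ha : a ≠ 0) (hμ : 0 < μ) (l N : ℕ) (φ : Conf)
    (p : ℕ) : IsContinuousBoundaryValue (lhsKernel a μ l N φ p)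
      ((∑ j ∈ Finset.range (2 * (N + 1) + 1), hbarPow j
        (∑ J ∈ Finset.finAntidiagonal l j,
          (∏ i, ((J i).factorial : ℝ))⁻¹ • unrenormTerm a μ l N φ J)) p) := by
  rw [Finset.sum_apply]
  refine (IsContinuousBoundaryValue.sum _ fun j _ => ?_).congr fun ε hε x =>
    lhsKernel_eq ha hμ l N φ p hε x
  unfold hbarPow
  split_ifs with hj
  · rw [Finset.sum_apply]
    exact IsContinuousBoundaryValue.sum _ fun J _ =>
      (isContinuousBoundaryValue_unrenormTerm ha hμ l N φ J (p - j)).smul _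
  · exact IsContinuousBoundaryValue.zero

end

end SineGordon

theorem mainTheorem10 (a μ : ℝ) (ha : 0 < a) (hμ : 0 < μ) (l N : ℕ) (φ : SineGordon.Conf) :
    (∀ p, ∃ u, SineGordon.IsBoundaryValue (SineGordon.lhsKernel a μ l N φ p) u) ∧
    (∀ (J : Fin l → ℕ) (q : ℕ), ∃ u,
      SineGordon.IsBoundaryValue (SineGordon.termKernel a μ l N φ J q) u) ∧
    SineGordon.unrenormT a μ l N φ =
      ∑ j ∈ Finset.range (2 * (N + 1) + 1), SineGordon.hbarPow j
        (∑ J ∈ Finset.finAntidiagonal l j,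
          (∏ i, ((J i).factorial : ℝ))⁻¹ • SineGordon.unrenormTerm a μ l N φ J) :=
  ⟨fun p => ⟨_, (SineGordon.isContinuousBoundaryValue_lhsKernel ha.ne' hμ l N φ p).2⟩,
    fun J q => ⟨_, (SineGordon.isContinuousBoundaryValue_unrenormTerm ha.ne' hμ l N φ J q).2⟩,
    funext fun p => SineGordon.boundaryValue_eq
      (SineGordon.isContinuousBoundaryValue_lhsKernel ha.ne' hμ l N φ p).2⟩
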